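/- All locally compact groups are Hausdorff and second countable. Let $G$ be a unimodular locally compact group with a Haar measure $\gamma$, and suppose that $G$ has a compact open subgroup $K_0$ with $\gamma(K_0)=1$. Let $G^\circ=(G,\gamma)$. A polyendomorphism of $G^\circ$ is either the zero measure $0$ on $G\times G$, or a closed subgroup $R\subset G\times G$ with a fixed Haar measure $\rho$ whose images under the projections $(g,h)\mapsto g$ and $(g,h)\mapsto h$ are both $\le\gamma$. Put $$\operatorname{dom}R=\{g:\exists h,\ (g,h)\in R\},\quad \operatorname{im}R=\{h:\exists g,\ (g,h)\in R\},\quad \ker R=\{g:(g,1)\in R\},\quad \operatorname{indef}R=\{h:(1,h)\in R\}.$$ The two images of $\rho$ then have the form $\alpha\cdot\gamma|_{\operatorname{dom}R}$ and $\beta\cdot\gamma|_{\operatorname{im}R}$ with constants $\alpha=\alpha(R)$, $\beta=\beta(R)$. Let $\mathrm{Polh}(G^\circ,G^\circ)$ be the set of all polyendomorphisms, with the topology of convergence of the integrals $\int\varphi(g)\psi(h)\,d\rho(g,h)$ for all continuous compactly supported $\varphi,\psi:G\to\mathbb R$. The product $S=TR$ of nonzero polyendomorphisms is the subgroup $\{(g,k):\exists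 h,\ (g,h)\in R,\ (h,k)\in T\}$ with the Haar measure normalized by $$\alpha(S)=\frac{\alpha(R)\,\alpha(T)}{[\operatorname{indef}R:\operatorname{indef}R\cap\operatorname{dom}T]},\qquad \beta(S)=\frac{\beta(R)\,\beta(T)}{[\ker T:\ker T\cap\operatorname{im}R]};$$ a product with a factor $0$ is $0$. Let $\Lambda\subset\mathbb N$ be the multiplicative semigroup generated by the indices $[K_1:K_2]$ of compact open subgroups $K_1\supset K_2$ of $G$, and let $\mathrm{Polh}_\Lambda(G^\circ,G^\circ)$ be the set consisting of $0$ and of all nonzero polyendomorphisms $R$ with $\alpha(R)^{-1},\beta(R)^{-1}\in\Lambda$. Then the product is well defined and makes $\mathrm{Polh}(G^\circ,G^\circ)$ a semigroup, and $\mathrm{Polh}_\Lambda(G^\circ,G^\circ)$ is a compact and closed subsemigroup of it. -/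

import Mathlib

open MeasureTheory Topology
open scoped NNReal ENNReal CompactlySupported

namespace Polyhom

section Relations

/-! ### Multiplicative relations, i.e. subgroups of `G × H` -/

variable {G H K : Type*} [Group G] [Group H] [Group K]

/-- The domain of a multiplicative relation: its projection to `G`. -/
def dom (R : Subgroup (G × H)) : Subgroup G := R.map (MonoidHom.fst G H)

/-- The image of a multiplicative relation: its projection to `H`. -/
def im (R : Subgroup (G × H)) : Subgroup H := R.map (MonoidHom.snd G H)

/-- The kernel of a multiplicative relation: its intersection with `G ⊆ G × H`. -/
def ker (R : Subgroup (G × H)) : Subgroup G := R.comap (MonoidHom.inl G H)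

/-- The indefinity of a multiplicative relation: its intersection with `H ⊆ G × H`. -/
def indef (R : Subgroup (G × H)) : Subgroup H := R.comap (MonoidHom.inr G H)

/-- The product `T R` of multiplicative relations `R : G ⇉ H` and `T : H ⇉ K`. -/
def comp (T : Subgroup (H × K)) (R : Subgroup (G × H)) : Subgroup (G × K) where
  carrier := {p | ∃ h : H, (p.1, h) ∈ R ∧ (h, p.2) ∈ T}
  one_mem' := ⟨1, R.one_mem, T.one_mem⟩
  mul_mem' := by
    rintro p q ⟨h, hR, hT⟩ ⟨h', hR', hT'⟩
    exact ⟨h * h', R.mul_mem hR hR', T.mul_mem hT hT'⟩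
  inv_mem' := by
    rintro p ⟨h, hR, hT⟩
    exact ⟨h⁻¹, R.inv_mem hR, T.inv_mem hT⟩

end Relations

/-! ### Polyhomomorphisms -/

section Definition

variable {G H : Type*} [Group G] [TopologicalSpace G] [MeasurableSpace G]
  [Group H] [TopologicalSpace H] [MeasurableSpace H]

/-- A closed subgroup `R ⊆ G × H` with a fixed Haar measure whose images under the two
projections are dominated by the given Haar measures `γ` on `G` and `η` on `H`. The Haar measure
of `R` is recorded as a measure `meas` on `G × H` (its image under the inclusion). -/
@[ext]
structure Nonzero (γ : Measure G) (η : Measure H) where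
  /-- the underlying multiplicative relation -/
  rel : Subgroup (G × H)
  /-- the Haar measure of the subgroup, as a measure on `G × H` -/
  meas : Measure (G × H)
  isClosed_rel : IsClosed (rel : Set (G × H))
  isHaar : ∃ ρ : Measure rel, ρ.IsHaarMeasure ∧ meas = ρ.map (Subtype.val : rel → G × H)
  map_fst_le : meas.map Prod.fst ≤ γ
  map_snd_le : meas.map Prod.snd ≤ η

/-- The set of polyhomomorphisms `(G, γ) ↣ (H, η)`: either the zero measure on `G × H`, or a closed
subgroup with a fixed Haar measure as above. -/
inductive Polh (γ : Measure G) (η : Measure H) where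
  | zero : Polh γ η
  | ofNonzero (R : Nonzero γ η) : Polh γ η

/-- The measure on `G × H` determined by a polyhomomorphism. -/
noncomputable def Polh.meas {γ : Measure G} {η : Measure H} : Polh γ η → Measure (G × H)
  | .zero => 0
  | .ofNonzero R => R.meas

/-- The topology of the convergence of all integrals `∫ φ(g) ψ(h) dρ(g, h)` with `φ`, `ψ`
continuous and compactly supported. -/
noncomputable instance (γ : Measure G) (η : Measure H) : TopologicalSpace (Polh γ η) :=
  TopologicalSpace.induced
    (fun (R : Polh γ η) (p : C_c(G, ℝ) × C_c(H, ℝ)) =>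
      ∫ x : G × H, (p.1 x.1 * p.2 x.2) ∂(R.meas))
    inferInstance

end Definition

/-! ### The constants `α` and `β` -/

/-- The image of a Haar measure under a homomorphism to `G`, if it is dominated by the Haar measure
of `G`, is proportional to the restriction of the latter to the range of the homomorphism. -/
theorem exists_map_eq_smul_restrict {S G : Type*}
    [Group S] [TopologicalSpace S] [IsTopologicalGroup S] [SigmaCompactSpace S]
    [MeasurableSpace S] [BorelSpace S]
    [Group G] [TopologicalSpace G] [IsTopologicalGroup G] [T2Space G] [LocallyCompactSpace G]
    [SecondCountableTopology G] [MeasurableSpace G] [BorelSpace G]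
    (γ : Measure G) [γ.IsHaarMeasure] (ρ : Measure S) [ρ.IsHaarMeasure]
    (f : S →* G) (hf : Continuous f) (hle : ρ.map f ≤ γ) :
    ∃ a : ℝ≥0, ρ.map f = a • γ.restrict (f.range : Set G) := by
  have hmeas : MeasurableSet (f.range : Set G) := by
    rw [MonoidHom.coe_range, ← Set.image_univ, ← iUnion_compactCovering, Set.image_iUnion]
    exact MeasurableSet.iUnion fun n => ((isCompact_compactCovering S n).image hf).measurableSet
  have hpre : f ⁻¹' (f.range : Set G) = Set.univ := by
    ext s; simp
  have hpos : 0 < γ (f.range : Set G) := by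
    have h1 : ρ.map f (f.range : Set G) ≤ γ (f.range : Set G) := hle _
    rw [Measure.map_apply hf.measurable hmeas, hpre] at h1
    exact lt_of_lt_of_le (isOpen_univ.measure_pos ρ Set.univ_nonempty) h1
  have hopen : IsOpen (f.range : Set G) := by
    have h1 := Measure.div_mem_nhds_one_of_haar_pos γ _ hmeas hpos
    refine Subgroup.isOpen_of_mem_nhds f.range (g := 1) (Filter.mem_of_superset h1 ?_)
    rintro _ ⟨x, hx, y, hy, rfl⟩
    exact f.range.div_mem hx hy
  have hemb : IsOpenEmbedding (f.range.subtype : f.range → G) := hopen.isOpenEmbedding_subtypeVal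
  have : LocallyCompactSpace f.range := hopen.locallyCompactSpace
  have : SecondCountableTopology f.range :=
    inferInstanceAs (SecondCountableTopology (f.range : Set G))
  have hmulG : MeasurableMul G := inferInstance
  have hHaar : (γ.comap f.range.subtype).IsHaarMeasure :=
    Measure.IsHaarMeasure.comap (mH := hmulG) γ hemb
  have hfr : Continuous f.rangeRestrict := hf.subtype_mk _
  have hval : (ρ.map f.rangeRestrict).map f.range.subtype = ρ.map f := by
    rw [Measure.map_map hemb.continuous.measurable hfr.measurable]
    rfl
  have hinv : (ρ.map f.rangeRestrict).IsMulLeftInvariant :=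
    isMulLeftInvariant_map f.rangeRestrict.toMulHom hfr.measurable f.rangeRestrict_surjective
  have hfin : IsFiniteMeasureOnCompacts (ρ.map f.rangeRestrict) := by
    refine ⟨fun C hC => ?_⟩
    have h1 : ρ.map f.rangeRestrict C = ρ.map f (f.range.subtype '' C) := by
      rw [← hval, hemb.measurableEmbedding.map_apply,
        Set.preimage_image_eq _ hemb.injective]
    rw [h1]
    exact lt_of_le_of_lt (hle _) (hC.image hemb.continuous).measure_lt_top
  have h1 := Measure.isMulLeftInvariant_eq_smul (ρ.map f.rangeRestrict)
    (γ.comap f.range.subtype)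
  refine ⟨Measure.haarScalarFactor (ρ.map f.rangeRestrict) (γ.comap f.range.subtype), ?_⟩
  have h2 := congrArg (Measure.map f.range.subtype) h1
  rw [hval, Measure.map_smul, hemb.measurableEmbedding.map_comap] at h2
  rwa [show Set.range f.range.subtype = (f.range : Set G) from Subtype.range_coe] at h2

set_option linter.unusedSectionVars false

section Constants

variable {G H K : Type*}
  [Group G] [TopologicalSpace G] [IsTopologicalGroup G] [T2Space G] [LocallyCompactSpace G]
  [SecondCountableTopology G] [MeasurableSpace G] [BorelSpace G]
  [Group H] [TopologicalSpace H] [IsTopologicalGroup H] [T2Space H] [LocallyCompactSpace H]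
  [SecondCountableTopology H] [MeasurableSpace H] [BorelSpace H]
  [Group K] [TopologicalSpace K] [IsTopologicalGroup K] [T2Space K] [LocallyCompactSpace K]
  [SecondCountableTopology K] [MeasurableSpace K] [BorelSpace K]
  {γ : Measure G} [γ.IsHaarMeasure] {η : Measure H} [η.IsHaarMeasure]
  {κ : Measure K} [κ.IsHaarMeasure]

theorem Nonzero.exists_alpha (R : Nonzero γ η) :
    ∃ a : ℝ≥0, R.meas.map Prod.fst = a • γ.restrict (dom R.rel : Set G) := by
  obtain ⟨ρ, hρ, h⟩ := R.isHaar
  have : SigmaCompactSpace R.rel := R.isClosed_rel.isClosedEmbedding_subtypeVal.sigmaCompactSpace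
  have hm : R.meas.map Prod.fst = ρ.map ((MonoidHom.fst G H).comp R.rel.subtype) := by
    rw [h, Measure.map_map measurable_fst measurable_subtype_coe]
    rfl
  have hd : ((MonoidHom.fst G H).comp R.rel.subtype).range = dom R.rel := by
    rw [MonoidHom.range_comp, Subgroup.range_subtype]; rfl
  have := exists_map_eq_smul_restrict γ ρ ((MonoidHom.fst G H).comp R.rel.subtype)
    (continuous_fst.comp continuous_subtype_val) (hm ▸ R.map_fst_le)
  rwa [← hm, hd] at this

theorem Nonzero.exists_beta (R : Nonzero γ η) :
    ∃ b : ℝ≥0, R.meas.map Prod.snd = b • η.restrict (im R.rel : Set H) := by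
  obtain ⟨ρ, hρ, h⟩ := R.isHaar
  have : SigmaCompactSpace R.rel := R.isClosed_rel.isClosedEmbedding_subtypeVal.sigmaCompactSpace
  have hm : R.meas.map Prod.snd = ρ.map ((MonoidHom.snd G H).comp R.rel.subtype) := by
    rw [h, Measure.map_map measurable_snd measurable_subtype_coe]
    rfl
  have hd : ((MonoidHom.snd G H).comp R.rel.subtype).range = im R.rel := by
    rw [MonoidHom.range_comp, Subgroup.range_subtype]; rfl
  have := exists_map_eq_smul_restrict η ρ ((MonoidHom.snd G H).comp R.rel.subtype)
    (continuous_snd.comp continuous_subtype_val) (hm ▸ R.map_snd_le)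
  rwa [← hm, hd] at this

/-- The constant `α(R)`: the image of the measure of `R` in `G` is `α(R) γ` on `dom R`. -/
noncomputable def Nonzero.alpha (R : Nonzero γ η) : ℝ≥0 := R.exists_alpha.choose

/-- The constant `β(R)`: the image of the measure of `R` in `H` is `β(R) η` on `im R`. -/
noncomputable def Nonzero.beta (R : Nonzero γ η) : ℝ≥0 := R.exists_beta.choose

theorem Nonzero.map_fst_meas (R : Nonzero γ η) :
    R.meas.map Prod.fst = R.alpha • γ.restrict (dom R.rel : Set G) := R.exists_alpha.choose_spec

theorem Nonzero.map_snd_meas (R : Nonzero γ η) :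
    R.meas.map Prod.snd = R.beta • η.restrict (im R.rel : Set H) := R.exists_beta.choose_spec

/-- `S` is the product `T R` of the polyhomomorphisms `R : G ↣ H` and `T : H ↣ K`: the product of
relations, with the Haar measure normalized by
`α(S) = α(R) α(T) / [indef R : indef R ∩ dom T]` and `β(S) = β(R) β(T) / [ker T : ker T ∩ im R]`.
A product with a zero factor is zero. -/
def IsProduct : Polh η κ → Polh γ η → Polh γ κ → Prop
  | .ofNonzero T, .ofNonzero R, .ofNonzero S =>
      S.rel = comp T.rel R.rel ∧
      S.alpha = R.alpha * T.alpha / ((indef R.rel ⊓ dom T.rel).relIndex (indef R.rel) : ℕ) ∧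
      S.beta = R.beta * T.beta / ((ker T.rel ⊓ im R.rel).relIndex (ker T.rel) : ℕ)
  | .ofNonzero _, .ofNonzero _, .zero => False
  | _, _, S => S = .zero

end Constants

/-! ### The semigroup `Λ` and the set `Polh_Λ` -/

/-- The multiplicative semigroup `Λ(G) ⊆ ℕ` of all products of indices `[K₁ : K₂]` of compact open
subgroups `K₁ ⊇ K₂` of `G`. -/
def indexSemigroup (G : Type*) [Group G] [TopologicalSpace G] : Subsemigroup ℕ :=
  Subsemigroup.closure {n | ∃ K₁ K₂ : Subgroup G,
    IsCompact (K₁ : Set G) ∧ IsOpen (K₁ : Set G) ∧ IsCompact (K₂ : Set G) ∧ IsOpen (K₂ : Set G) ∧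
    K₂ ≤ K₁ ∧ n = K₂.relIndex K₁}

/-- The set `Polh_Λ(G, G)` of polyendomorphisms of `(G, γ)`: zero, and all nonzero `R` with
`α(R)⁻¹, β(R)⁻¹ ∈ Λ(G)`. -/
def polhΛ {G : Type*} [Group G] [TopologicalSpace G] [IsTopologicalGroup G] [T2Space G]
    [LocallyCompactSpace G] [SecondCountableTopology G] [MeasurableSpace G] [BorelSpace G]
    (γ : Measure G) [γ.IsHaarMeasure] : Set (Polh γ γ) :=
  {.zero} ∪ {P | ∃ R : Nonzero γ γ, P = .ofNonzero R ∧
    (∃ n ∈ indexSemigroup G, R.alpha⁻¹ = (n : ℝ≥0)) ∧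
    (∃ m ∈ indexSemigroup G, R.beta⁻¹ = (m : ℝ≥0))}

end Polyhom

/-! Domination by `γ` makes both projections of a nonzero polyendomorphism proper: infinitely many
disjoint translates of equal positive mass cannot fit over a compact set
(`isCompact_preimage_of_map_le`). Hence `ker` and `indef` are compact. Moreover `dom` and `im` have
positive measure and so are open, which makes all indices in the normalization finite. Exchanging
the two factors (`Nonzero.swap`) turns each statement about `α` into one about `β`.

Product. The measure of `TR` is the image of a Haar measure on the fibre product of `R` and `T` over
the middle group, scaled to be compatible with both given measures (`Nonzero.exists_fiber_measure`).
The index in `α(TR)` counts the translates by `indef R` that fill the fibres of `R` from their part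
with second coordinate in `dom T` (`Nonzero.map_fst_restrict`). Since the relation and `α` determine
the measure, the product is unique, and associativity reduces to an index identity
(`relIndex_mul_relIndex_comp`). The set given by `Λ` is stable because the index of an open subgroup
in a compact one is also an index between compact open subgroups (`relIndex_mem_indexSemigroup`).

Compactness. Bounds by `γ` give vague limits along ultrafilters. A limit is invariant under the
limit subgroup and concentrated on it, so it is zero or again a polyhomomorphism (`exists_limit`).
Measuring a suitable compact open box exhibits `α(R)⁻¹` as a limit of elements of `Λ`, and `Λ ⊆ ℕ`
is closed in `ℝ` (`Nonzero.inv_alpha_mem_of_tendsto`). Closedness follows because the topology is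
Hausdorff. -/

namespace Polyhom

open Set Filter
open scoped Pointwise

set_option linter.unusedSectionVars false

/-! ### Elements of domain, image and indefinity -/

section Relations

variable {G H : Type*} [Group G] [Group H]

theorem mem_dom {R : Subgroup (G × H)} {g : G} : g ∈ dom R ↔ ∃ h, (g, h) ∈ R := by
  simp [dom]

theorem mem_im {R : Subgroup (G × H)} {h : H} : h ∈ im R ↔ ∃ g, (g, h) ∈ R := by
  simp [im]

theorem mem_indef {R : Subgroup (G × H)} {h : H} : h ∈ indef R ↔ (1, h) ∈ R := Iff.rfl

end Relations

/-! ### Haar measures and homomorphisms, open and closed subgroups -/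

section HaarTools

variable {G : Type*} [Group G] [TopologicalSpace G] [IsTopologicalGroup G] [T2Space G]
  [LocallyCompactSpace G] [SecondCountableTopology G] [MeasurableSpace G] [BorelSpace G]

/-- A continuous homomorphism pushing a Haar measure to a measure dominated by a locally finite
one is proper. -/
theorem isCompact_preimage_of_map_le {S : Type*} [Group S] [TopologicalSpace S]
    [IsTopologicalGroup S] [LocallyCompactSpace S] [MeasurableSpace S] [BorelSpace S]
    (γ : Measure G) [IsFiniteMeasureOnCompacts γ] (ρ : Measure S) [ρ.IsHaarMeasure]
    (f : S →* G) (hf : Continuous f) (hle : ρ.map f ≤ γ) {C : Set G} (hC : IsCompact C) :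
    IsCompact (f ⁻¹' C) := by
  by_contra hnc
  obtain ⟨U, hUc, hU⟩ := exists_compact_mem_nhds (1 : S)
  obtain ⟨V, hV, hVU⟩ := exists_nhds_split_inv hU
  have hcl : IsClosed (f ⁻¹' C) := hC.isClosed.preimage hf
  -- Finitely many translates `x • U` cannot cover a closed noncompact set, so one can keep choosing
  -- points outside all earlier translates.
  have hstep : ∀ s : Finset S, (∀ x ∈ s, x ∈ f ⁻¹' C) →
      ∃ y, y ∈ f ⁻¹' C ∧ ∀ x ∈ s, x⁻¹ * y ∉ U := by
    intro s _
    by_contra! h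
    refine hnc (IsCompact.of_isClosed_subset (s := ⋃ x ∈ s, (x • U))
      (s.isCompact_biUnion fun x _ => hUc.smul x) hcl fun y hy => ?_)
    obtain ⟨x, hx, hxy⟩ := h y hy
    exact mem_biUnion hx ⟨_, hxy, by simp⟩
  obtain ⟨x, hxC, hx⟩ := exists_seq_of_forall_finset_exists _ _ hstep
  have hdisj : Pairwise (Function.onFun Disjoint fun n => x n • interior V) := by
    have key : ∀ m n, m < n → Disjoint (x m • interior V) (x n • interior V) := by
      intro m n hmn
      refine disjoint_left.2 ?_
      rintro _ ⟨v, hv, rfl⟩ ⟨w, hw, hvw⟩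
      refine hx m n hmn ?_
      have : (x m)⁻¹ * x n = v / w := by
        simp only [smul_eq_mul] at hvw
        rw [inv_mul_eq_iff_eq_mul, ← mul_div_assoc, ← hvw, mul_div_assoc, div_self', mul_one]
      rw [this]
      exact hVU v (interior_subset hv) w (interior_subset hw)
    intro m n hmn
    rcases lt_or_gt_of_ne hmn with h | h
    · exact key m n h
    · exact (key n m h).symm
  have hpos : ρ (interior V) ≠ 0 :=
    (isOpen_interior.measure_pos ρ ⟨1, mem_interior_iff_mem_nhds.2 hV⟩).ne'
  have htop : ρ (⋃ n, x n • interior V) = ∞ := by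
    rw [measure_iUnion hdisj fun n => (isOpen_interior.smul _).measurableSet]
    simp only [measure_smul]
    exact ENNReal.tsum_const_eq_top_of_ne_zero hpos
  have hcomp : IsCompact (C * f '' U) := hC.mul (hUc.image hf)
  -- The contradiction: the translates have infinite total mass but lie over a compact set, where
  -- domination by `γ` keeps the mass finite.
  have hsub : (⋃ n, x n • interior V) ⊆ f ⁻¹' (C * f '' U) := by
    refine iUnion_subset fun n => ?_
    rintro _ ⟨v, hv, rfl⟩
    have hvU : v ∈ U := by
      simpa using hVU v (interior_subset hv) 1 (mem_of_mem_nhds hV)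
    exact ⟨f (x n), hxC n, f v, mem_image_of_mem _ hvU, by simp⟩
  have : ρ (f ⁻¹' (C * f '' U)) < ∞ :=
    ((Measure.le_map_apply hf.measurable.aemeasurable _).trans (hle _)).trans_lt
      hcomp.measure_lt_top
  exact absurd (measure_mono hsub) (by rw [htop]; exact not_le.2 this)

/-- A nonzero measure concentrated on a closed subgroup and invariant under its left translations
comes from a Haar measure of the subgroup. -/
theorem exists_haar_of_invariant {S : Subgroup G} (hS : IsClosed (S : Set G)) (m : Measure G)
    [IsFiniteMeasureOnCompacts m] (hm : m ≠ 0) (hc : m (S : Set G)ᶜ = 0)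
    (hinv : ∀ x ∈ S, m.map (x * ·) = m) :
    ∃ ρ : Measure S, ρ.IsHaarMeasure ∧ m = ρ.map (Subtype.val : S → G) := by
  have hemb : IsClosedEmbedding (Subtype.val : S → G) := hS.isClosedEmbedding_subtypeVal
  have hme : MeasurableEmbedding (Subtype.val : S → G) := hemb.measurableEmbedding
  have : LocallyCompactSpace S := hemb.locallyCompactSpace
  have : SecondCountableTopology S := inferInstanceAs (SecondCountableTopology (S : Set G))
  have hval : (m.comap (Subtype.val : S → G)).map Subtype.val = m := by
    rw [hme.map_comap]
    refine Measure.restrict_eq_self_of_ae_mem ?_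
    rw [show range (Subtype.val : S → G) = (S : Set G) from Subtype.range_coe]
    exact hc
  have hfin : IsFiniteMeasureOnCompacts (m.comap (Subtype.val : S → G)) :=
    IsFiniteMeasureOnCompacts.comap' m hemb.continuous hme
  have hleft : (m.comap (Subtype.val : S → G)).IsMulLeftInvariant := by
    refine ⟨fun x => ?_⟩
    rw [← hme.comap_map (Measure.map _ _), Measure.map_map hme.measurable (measurable_const_mul x)]
    have : (Subtype.val : S → G) ∘ (x * ·) = ((x : G) * ·) ∘ Subtype.val := by ext; simp
    rw [this, ← Measure.map_map (measurable_const_mul _) hme.measurable, hval, hinv x x.2]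
  have hne : NeZero (m.comap (Subtype.val : S → G)) := by
    refine ⟨fun h => hm ?_⟩
    rw [← hval, h, Measure.map_zero]
  have := isOpenPosMeasure_of_mulLeftInvariant_of_regular (μ := m.comap (Subtype.val : S → G))
  exact ⟨m.comap Subtype.val, ⟨⟩, hval.symm⟩

/-- Steinhaus: the quotients of elements of a set of positive measure fill a neighbourhood of `1`.
-/
theorem isOpen_of_measure_pos (γ : Measure G) [γ.IsHaarMeasure] (D : Subgroup G)
    (hD : MeasurableSet (D : Set G)) (hpos : 0 < γ (D : Set G)) : IsOpen (D : Set G) := by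
  have h1 := Measure.div_mem_nhds_one_of_haar_pos γ _ hD hpos
  refine Subgroup.isOpen_of_mem_nhds D (g := 1) (Filter.mem_of_superset h1 ?_)
  rintro _ ⟨x, hx, y, hy, rfl⟩
  exact D.div_mem hx hy

theorem smul_restrict_injective (γ : Measure G) [γ.IsHaarMeasure] {U : Set G} (hU : IsOpen U)
    (hne : U.Nonempty) {a b : ℝ≥0} (h : a • γ.restrict U = b • γ.restrict U) : a = b := by
  obtain ⟨x, hx⟩ := hne
  obtain ⟨C, hC, hCx⟩ := exists_compact_mem_nhds x
  have hpos : γ (C ∩ U) ≠ 0 :=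
    (Measure.measure_pos_of_mem_nhds γ (inter_mem hCx (hU.mem_nhds hx))).ne'
  have hfin : γ (C ∩ U) ≠ ∞ := measure_ne_top_of_subset inter_subset_left hC.measure_lt_top.ne
  have h1 := congrArg (fun m => m C) h
  simp only [Measure.smul_apply, Measure.restrict_apply hC.measurableSet] at h1
  rw [ENNReal.smul_def, ENNReal.smul_def, smul_eq_mul, smul_eq_mul,
    ENNReal.mul_left_inj hpos hfin] at h1
  exact_mod_cast h1

theorem _root_.IsClosed.measurableSet_image {X Y : Type*} [TopologicalSpace X] [SigmaCompactSpace X]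
    [TopologicalSpace Y] [T2Space Y] [MeasurableSpace Y] [BorelSpace Y] {s : Set X}
    (hs : IsClosed s) {f : X → Y} (hf : Continuous f) : MeasurableSet (f '' s) := by
  have : s = ⋃ n, compactCovering X n ∩ s := by
    rw [← iUnion_inter, iUnion_compactCovering, univ_inter]
  rw [this, image_iUnion]
  exact MeasurableSet.iUnion fun n =>
    (((isCompact_compactCovering X n).inter_right hs).image hf).measurableSet

theorem finite_quotient_of_isCompact {L D : Subgroup G} (hL : IsCompact (L : Set G))
    (hD : IsOpen (D : Set G)) : Finite (L ⧸ D.subgroupOf L) := by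
  have : CompactSpace L := isCompact_iff_compactSpace.1 hL
  exact Subgroup.quotient_finite_of_isOpen _ (hD.preimage continuous_subtype_val)

theorem relIndex_ne_zero_of_isCompact {L D : Subgroup G} (hL : IsCompact (L : Set G))
    (hD : IsOpen (D : Set G)) : D.relIndex L ≠ 0 := by
  have := finite_quotient_of_isCompact hL hD
  exact Nat.card_ne_zero.2 ⟨⟨QuotientGroup.mk 1⟩, this⟩

end HaarTools

/-! ### Structure of a nonzero polyhomomorphism and its constants -/

section Structure

variable {G H : Type*}
  [Group G] [TopologicalSpace G] [IsTopologicalGroup G] [T2Space G] [LocallyCompactSpace G]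
  [SecondCountableTopology G] [MeasurableSpace G] [BorelSpace G]
  [Group H] [TopologicalSpace H] [IsTopologicalGroup H] [T2Space H] [LocallyCompactSpace H]
  [SecondCountableTopology H] [MeasurableSpace H] [BorelSpace H]
  {γ : Measure G} [γ.IsHaarMeasure] {η : Measure H} [η.IsHaarMeasure]

theorem isFiniteMeasureOnCompacts_of_map_fst_le {m : Measure (G × H)} (h : m.map Prod.fst ≤ γ) :
    IsFiniteMeasureOnCompacts m := by
  refine ⟨fun C hC => ?_⟩
  have hC' := hC.image continuous_fst
  calc m C ≤ m (Prod.fst ⁻¹' (Prod.fst '' C)) := measure_mono (subset_preimage_image _ _)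
    _ ≤ m.map Prod.fst (Prod.fst '' C) :=
      Measure.le_map_apply measurable_fst.aemeasurable _
    _ ≤ γ (Prod.fst '' C) := h _
    _ < ∞ := hC'.measure_lt_top

namespace Nonzero

instance (R : Nonzero γ η) : IsFiniteMeasureOnCompacts R.meas :=
  isFiniteMeasureOnCompacts_of_map_fst_le R.map_fst_le

theorem meas_compl (R : Nonzero γ η) : R.meas (R.rel : Set (G × H))ᶜ = 0 := by
  obtain ⟨ρ, -, h⟩ := R.isHaar
  rw [h, Measure.map_apply measurable_subtype_coe R.isClosed_rel.measurableSet.compl]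
  convert measure_empty (μ := ρ)
  ext x
  simp

theorem ae_mem (R : Nonzero γ η) : ∀ᵐ x ∂(R.meas), x ∈ R.rel := R.meas_compl

theorem map_mul_left (R : Nonzero γ η) {x : G × H} (hx : x ∈ R.rel) :
    R.meas.map (x * ·) = R.meas := by
  obtain ⟨ρ, hρ, h⟩ := R.isHaar
  have hc : (x * ·) ∘ (Subtype.val : R.rel → G × H) =
      Subtype.val ∘ ((⟨x, hx⟩ : R.rel) * ·) := by ext <;> simp
  rw [h, Measure.map_map (measurable_const_mul _) measurable_subtype_coe, hc,
    ← Measure.map_map measurable_subtype_coe (measurable_const_mul _), map_mul_left_eq_self]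

theorem meas_smul (R : Nonzero γ η) {x : G × H} (hx : x ∈ R.rel) (s : Set (G × H)) :
    R.meas (x • s) = R.meas s := by
  conv_lhs => rw [← R.map_mul_left hx]
  rw [(measurableEmbedding_mulLeft x).map_apply]
  congr 1
  ext y
  simp [mem_smul_set]

theorem meas_pos (R : Nonzero γ η) {U : Set (G × H)} (hU : IsOpen U) {x : G × H} (hx : x ∈ R.rel)
    (hxU : x ∈ U) : 0 < R.meas U := by
  obtain ⟨ρ, hρ, h⟩ := R.isHaar
  rw [h, Measure.map_apply measurable_subtype_coe hU.measurableSet]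
  exact (hU.preimage continuous_subtype_val).measure_pos ρ ⟨⟨x, hx⟩, hxU⟩

/-- Properness of the projection `R → G`, forced by `map_fst_le`; over the point `1` it gives
compactness of `indef R`. -/
theorem isCompact_inter_fst (R : Nonzero γ η) {C : Set G} (hC : IsCompact C) :
    IsCompact ((R.rel : Set (G × H)) ∩ Prod.fst ⁻¹' C) := by
  obtain ⟨ρ, hρ, h⟩ := R.isHaar
  have : LocallyCompactSpace R.rel := R.isClosed_rel.isClosedEmbedding_subtypeVal.locallyCompactSpace
  have hm : R.meas.map Prod.fst = ρ.map ((MonoidHom.fst G H).comp R.rel.subtype) := by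
    rw [h, Measure.map_map measurable_fst measurable_subtype_coe]
    rfl
  have := (isCompact_preimage_of_map_le γ ρ ((MonoidHom.fst G H).comp R.rel.subtype)
    (continuous_fst.comp continuous_subtype_val) (hm ▸ R.map_fst_le) hC).image
      continuous_subtype_val
  convert this
  ext x
  simp only [mem_inter_iff, SetLike.mem_coe, mem_preimage, MonoidHom.coe_comp, mem_image,
    Function.comp_apply, Subtype.exists]
  constructor
  · rintro ⟨h1, h2⟩
    exact ⟨x, h1, h2, rfl⟩
  · rintro ⟨y, h1, h2, rfl⟩
    exact ⟨h1, h2⟩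

theorem isCompact_indef (R : Nonzero γ η) : IsCompact (indef R.rel : Set H) := by
  convert (R.isCompact_inter_fst (isCompact_singleton (x := (1 : G)))).image continuous_snd
  ext h
  simp [mem_indef]

/-- The opposite relation. -/
noncomputable def swap (R : Nonzero γ η) : Nonzero η γ where
  rel := R.rel.comap (MulEquiv.prodComm : H × G ≃* G × H).toMonoidHom
  meas := R.meas.map Prod.swap
  isClosed_rel := R.isClosed_rel.preimage continuous_swap
  isHaar := by
    have h1 : IsFiniteMeasureOnCompacts (R.meas.map (Prod.swap : G × H → H × G)) := by
      refine isFiniteMeasureOnCompacts_of_map_fst_le (γ := η) ?_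
      rw [Measure.map_map measurable_fst measurable_swap]
      exact R.map_snd_le
    refine exists_haar_of_invariant (R.isClosed_rel.preimage continuous_swap) _ ?_ ?_ ?_
    · rw [Ne, Measure.map_eq_zero_iff measurable_swap.aemeasurable, ← Measure.measure_univ_eq_zero]
      exact (R.meas_pos isOpen_univ R.rel.one_mem (mem_univ _)).ne'
    · refine (Measure.map_apply measurable_swap
        (R.isClosed_rel.preimage continuous_swap).measurableSet.compl).trans ?_
      exact R.meas_compl
    · intro x hx
      rw [Measure.map_map (measurable_const_mul _) measurable_swap]
      conv_rhs => rw [← R.map_mul_left hx, Measure.map_map measurable_swap (measurable_const_mul _)]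
      rfl
  map_fst_le := by
    rw [Measure.map_map measurable_fst measurable_swap]
    exact R.map_snd_le
  map_snd_le := by
    rw [Measure.map_map measurable_snd measurable_swap]
    exact R.map_fst_le

theorem dom_swap (R : Nonzero γ η) : dom R.swap.rel = im R.rel := by
  ext; simp only [mem_dom, mem_im]; rfl

theorem indef_swap (R : Nonzero γ η) : indef R.swap.rel = ker R.rel := rfl

theorem isCompact_inter_snd (R : Nonzero γ η) {C : Set H} (hC : IsCompact C) :
    IsCompact ((R.rel : Set (G × H)) ∩ Prod.snd ⁻¹' C) := by
  convert (R.swap.isCompact_inter_fst hC).image continuous_swap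
  ext ⟨g, h⟩
  simp only [mem_inter_iff, mem_image, Prod.exists, Prod.swap_prod_mk, Prod.mk.injEq]
  constructor
  · rintro ⟨h1, h2⟩
    exact ⟨h, g, ⟨h1, h2⟩, rfl, rfl⟩
  · rintro ⟨_, _, ⟨h1, h2⟩, rfl, rfl⟩
    exact ⟨h1, h2⟩

/-- The `R`-mass of `W` is positive and lies over this subgroup, so domination by `γ` gives the
subgroup positive measure. -/
theorem isOpen_dom_inf (R : Nonzero γ η) {W : Subgroup (G × H)} (hW : IsOpen (W : Set (G × H))) :
    IsOpen (dom (R.rel ⊓ W) : Set G) := by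
  have hset : (dom (R.rel ⊓ W) : Set G) = Prod.fst '' ((R.rel : Set (G × H)) ∩ W) := rfl
  have hmeas : MeasurableSet (dom (R.rel ⊓ W) : Set G) := by
    rw [hset]
    exact (R.isClosed_rel.inter (W.isClosed_of_isOpen hW)).measurableSet_image continuous_fst
  refine isOpen_of_measure_pos γ _ hmeas ?_
  calc 0 < R.meas W := R.meas_pos hW R.rel.one_mem W.one_mem
    _ ≤ R.meas (Prod.fst ⁻¹' (dom (R.rel ⊓ W) : Set G)) := by
      refine measure_mono_ae ?_
      filter_upwards [R.ae_mem] with x hx hxW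
      exact ⟨x, ⟨hx, hxW⟩, rfl⟩
    _ ≤ R.meas.map Prod.fst (dom (R.rel ⊓ W) : Set G) :=
      Measure.le_map_apply measurable_fst.aemeasurable _
    _ ≤ γ _ := R.map_fst_le _

theorem isOpen_dom (R : Nonzero γ η) : IsOpen (dom R.rel : Set G) := by
  simpa using R.isOpen_dom_inf (W := ⊤) isOpen_univ

theorem isOpen_im (R : Nonzero γ η) : IsOpen (im R.rel : Set H) := by
  rw [← R.dom_swap]
  exact R.swap.isOpen_dom

theorem alpha_eq_of_map_fst (R : Nonzero γ η) {a : ℝ≥0}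
    (h : R.meas.map Prod.fst = a • γ.restrict (dom R.rel : Set G)) : R.alpha = a :=
  smul_restrict_injective γ R.isOpen_dom ⟨1, one_mem _⟩ (R.map_fst_meas.symm.trans h)

theorem beta_eq_of_map_snd (R : Nonzero γ η) {b : ℝ≥0}
    (h : R.meas.map Prod.snd = b • η.restrict (im R.rel : Set H)) : R.beta = b :=
  smul_restrict_injective η R.isOpen_im ⟨1, one_mem _⟩ (R.map_snd_meas.symm.trans h)

theorem alpha_swap (R : Nonzero γ η) : R.swap.alpha = R.beta := by
  refine R.swap.alpha_eq_of_map_fst ?_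
  rw [dom_swap, ← R.map_snd_meas]
  exact Measure.map_map measurable_fst measurable_swap

theorem meas_ne_zero (R : Nonzero γ η) : R.meas ≠ 0 := by
  rw [Ne, ← Measure.measure_univ_eq_zero]
  exact (R.meas_pos isOpen_univ R.rel.one_mem (mem_univ _)).ne'

theorem alpha_ne_zero (R : Nonzero γ η) : R.alpha ≠ 0 := by
  intro h
  have := R.map_fst_meas
  rw [h, zero_smul, Measure.map_eq_zero_iff measurable_fst.aemeasurable] at this
  exact R.meas_ne_zero this

theorem alpha_le_one (R : Nonzero γ η) : R.alpha ≤ 1 := by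
  obtain ⟨C, hC, hC1⟩ := exists_compact_mem_nhds (1 : G)
  have hpos : γ (C ∩ dom R.rel) ≠ 0 :=
    (Measure.measure_pos_of_mem_nhds γ (inter_mem hC1 (R.isOpen_dom.mem_nhds (one_mem _)))).ne'
  have hfin : γ (C ∩ dom R.rel) ≠ ∞ :=
    measure_ne_top_of_subset inter_subset_left hC.measure_lt_top.ne
  have h1 := R.map_fst_le (C ∩ dom R.rel)
  rw [R.map_fst_meas, Measure.smul_apply,
    Measure.restrict_eq_self _ inter_subset_right, ENNReal.smul_def, smul_eq_mul] at h1
  have h2 : (R.alpha : ℝ≥0∞) ≤ 1 := by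
    rw [← ENNReal.mul_le_mul_iff_left hpos hfin, one_mul]
    exact h1
  exact_mod_cast h2

theorem beta_le_one (R : Nonzero γ η) : R.beta ≤ 1 := by
  rw [← R.alpha_swap]
  exact R.swap.alpha_le_one

/-- A nonzero polyhomomorphism is determined by its relation and the constant `α`. -/
theorem ext_of_alpha {R R' : Nonzero γ η} (hrel : R.rel = R'.rel) (ha : R.alpha = R'.alpha) :
    R = R' := by
  -- Uniqueness of Haar measure leaves one scalar, which equality of the `α` then forces to be `1`.
  have key : ∃ c : ℝ≥0, R'.meas = c • R.meas := by
    obtain ⟨ρ, hρ, h⟩ := R.isHaar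
    obtain ⟨ρ', hρ', h'⟩ := R'.isHaar
    revert ρ'
    rw [← hrel]
    intro ρ' hρ' h'
    have : LocallyCompactSpace R.rel :=
      R.isClosed_rel.isClosedEmbedding_subtypeVal.locallyCompactSpace
    have : SecondCountableTopology R.rel :=
      inferInstanceAs (SecondCountableTopology (R.rel : Set (G × H)))
    refine ⟨Measure.haarScalarFactor ρ' ρ, ?_⟩
    rw [h, h', ← Measure.map_smul, ← Measure.isMulLeftInvariant_eq_smul]
  obtain ⟨c, hc⟩ := key
  have h1 : R'.alpha = c * R.alpha := by
    refine R'.alpha_eq_of_map_fst ?_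
    rw [hc, Measure.map_smul, R.map_fst_meas, smul_smul, hrel]
  rw [ha] at h1
  have hc1 : c = 1 := by
    have := R'.alpha_ne_zero
    exact (mul_eq_right₀ this).1 h1.symm
  refine Nonzero.ext hrel ?_
  rw [hc, hc1, one_smul]

/-- Over `A`, the relation is the disjoint union of translates of its part in `W` by elements `(1,
q)`, with `q` running over coset representatives of `indef R` modulo its part in `W`. These
translations preserve the measure and the first coordinate. -/
theorem meas_inter_preimage_fst (R : Nonzero γ η) {W : Subgroup (G × H)}
    (hW : IsOpen (W : Set (G × H))) {A : Set G} (hA : MeasurableSet A)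
    (hAW : A ⊆ dom (R.rel ⊓ W)) :
    R.meas (Prod.fst ⁻¹' A) =
      ((W.comap (MonoidHom.inr G H)).relIndex (indef R.rel) : ℕ) *
        R.meas (Prod.fst ⁻¹' A ∩ W) := by
  set D : Subgroup H := W.comap (MonoidHom.inr G H) with hD
  have hDo : IsOpen (D : Set H) := hW.preimage (Continuous.prodMk_right (1 : G))
  have hfin := finite_quotient_of_isCompact R.isCompact_indef hDo
  let t : (indef R.rel ⧸ D.subgroupOf (indef R.rel)) → G × H := fun q => (1, (q.out : H))
  have ht : ∀ q, t q ∈ R.rel := fun q => q.out.2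
  have hmeas : ∀ q, MeasurableSet (t q • (Prod.fst ⁻¹' A ∩ (W : Set (G × H)))) := fun q =>
    ((measurable_fst hA).inter hW.measurableSet).const_smul _
  have hdisj : Pairwise (Function.onFun Disjoint
      fun q => t q • (Prod.fst ⁻¹' A ∩ (W : Set (G × H)))) := by
    intro q q' hne
    refine disjoint_left.2 ?_
    rintro _ ⟨x, hx, rfl⟩ ⟨y, hy, hxy⟩
    refine hne ?_
    rw [← q.out_eq', ← q'.out_eq', QuotientGroup.eq, Subgroup.mem_subgroupOf]
    have h1 : (t q)⁻¹ * t q' = x * y⁻¹ := by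
      simp only [smul_eq_mul] at hxy
      rw [inv_mul_eq_iff_eq_mul, ← mul_assoc, ← hxy, mul_inv_cancel_right]
    have h2 : (t q)⁻¹ * t q' ∈ W := by
      rw [h1]; exact W.mul_mem hx.2 (W.inv_mem hy.2)
    simpa [hD, t] using h2
  have hae : (Prod.fst ⁻¹' A : Set (G × H)) =ᵐ[R.meas]
      ⋃ q, t q • (Prod.fst ⁻¹' A ∩ (W : Set (G × H))) := by
    filter_upwards [R.ae_mem] with x hx
    refine propext ⟨fun hxA => ?_, fun hxU => ?_⟩
    · have hxA' : x.1 ∈ A := hxA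
      -- `(x.1, d)` is a point of `R ∩ W` in the fibre of `x`; they differ by an element of `indef
      -- R`, whose coset selects the translate containing `x`.
      obtain ⟨d, hdR, hdW⟩ := mem_dom.1 (hAW hxA')
      have hI : x.2 * d⁻¹ ∈ indef R.rel := by
        have := R.rel.mul_mem hx (R.rel.inv_mem hdR)
        rw [mem_indef]
        convert this using 1
        ext <;> simp
      let q : indef R.rel ⧸ D.subgroupOf (indef R.rel) := QuotientGroup.mk ⟨_, hI⟩
      have hq : (q.out : H)⁻¹ * (x.2 * d⁻¹) ∈ D := by
        have : (QuotientGroup.mk q.out : indef R.rel ⧸ D.subgroupOf (indef R.rel)) =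
          QuotientGroup.mk ⟨_, hI⟩ := q.out_eq'
        rw [QuotientGroup.eq, Subgroup.mem_subgroupOf] at this
        simpa using this
      refine mem_iUnion.2 ⟨q, mem_smul_set_iff_inv_smul_mem.2 ⟨?_, ?_⟩⟩
      · simpa [t] using hxA'
      · have h3 := W.mul_mem (Subgroup.mem_comap.1 hq) hdW
        have h4 : (t q)⁻¹ • x = (MonoidHom.inr G H) ((q.out : H)⁻¹ * (x.2 * d⁻¹)) * (x.1, d) := by
          ext <;> simp [t, mul_assoc]
        rw [h4]
        exact h3
    · obtain ⟨q, y, hy, rfl⟩ := mem_iUnion.1 hxU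
      have := hy.1
      simp only [mem_preimage] at this
      change (t q • y).1 ∈ A
      simpa [t] using this
  rw [measure_congr hae, measure_iUnion hdisj hmeas]
  simp only [R.meas_smul (ht _)]
  have := Fintype.ofFinite (indef R.rel ⧸ D.subgroupOf (indef R.rel))
  rw [tsum_fintype, Finset.sum_const, nsmul_eq_mul, Finset.card_univ, ← Nat.card_eq_fintype_card]
  rfl

/-- The image in `G` of the restriction of the measure of `R` to an open subgroup `W`. -/
theorem map_fst_restrict (R : Nonzero γ η) {W : Subgroup (G × H)}
    (hW : IsOpen (W : Set (G × H))) :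
    (R.meas.restrict W).map Prod.fst =
      (R.alpha / ((W.comap (MonoidHom.inr G H)).relIndex (indef R.rel) : ℕ)) •
        γ.restrict (dom (R.rel ⊓ W) : Set G) := by
  have hDo : IsOpen ((W.comap (MonoidHom.inr G H) : Subgroup H) : Set H) :=
    hW.preimage (Continuous.prodMk_right (1 : G))
  have hn := relIndex_ne_zero_of_isCompact R.isCompact_indef hDo
  have hM := R.isOpen_dom_inf hW
  ext B hB
  have hBM := hB.inter hM.measurableSet
  have h1 := R.meas_inter_preimage_fst hW hBM inter_subset_right
  have h2 : R.meas (Prod.fst ⁻¹' (B ∩ dom (R.rel ⊓ W)) ∩ W) = R.meas (Prod.fst ⁻¹' B ∩ W) := by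
    refine measure_congr ?_
    filter_upwards [R.ae_mem] with x hx
    refine propext ⟨fun h => ⟨h.1.1, h.2⟩, fun h => ⟨⟨h.1, x, ⟨hx, h.2⟩, rfl⟩, h.2⟩⟩
  have h3 : R.meas (Prod.fst ⁻¹' (B ∩ dom (R.rel ⊓ W))) =
      R.alpha * γ (B ∩ dom (R.rel ⊓ W)) := by
    have hsub : (dom (R.rel ⊓ W) : Set G) ⊆ dom R.rel := Subgroup.map_mono inf_le_left
    rw [← Measure.map_apply measurable_fst hBM, R.map_fst_meas, Measure.smul_apply,
      Measure.restrict_eq_self _ (inter_subset_right.trans hsub)]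
    rfl
  rw [Measure.map_apply measurable_fst hB, Measure.restrict_apply (measurable_fst hB),
    Measure.smul_apply, Measure.restrict_apply hB, ENNReal.smul_def, smul_eq_mul,
    ENNReal.coe_div (by exact_mod_cast hn), ENNReal.coe_natCast, ← ENNReal.mul_div_right_comm,
    ← h3, h1, h2, mul_comm, ENNReal.mul_div_cancel_right (by exact_mod_cast hn) (by simp)]

end Nonzero

end Structure

/-! ### The fibre product of two relations and its projections -/

section FiberProduct

variable {G H K : Type*} [Group G] [Group H] [Group K]

/-- The fibre product of two relations. -/
def fiberProduct (R : Subgroup (G × H)) (T : Subgroup (H × K)) :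
    Subgroup ((G × H) × (H × K)) where
  carrier := {x | x.1 ∈ R ∧ x.2 ∈ T ∧ x.1.2 = x.2.1}
  one_mem' := ⟨R.one_mem, T.one_mem, rfl⟩
  mul_mem' := by
    rintro x y ⟨h1, h2, h3⟩ ⟨h1', h2', h3'⟩
    exact ⟨R.mul_mem h1 h1', T.mul_mem h2 h2', by simp [h3, h3']⟩
  inv_mem' := by
    rintro x ⟨h1, h2, h3⟩
    exact ⟨R.inv_mem h1, T.inv_mem h2, by simp [h3]⟩

/-- The projection of the fibre product to the first relation. -/
def fiberFst (R : Subgroup (G × H)) (T : Subgroup (H × K)) : fiberProduct R T →* G × H :=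
  (MonoidHom.fst (G × H) (H × K)).comp (fiberProduct R T).subtype

/-- The projection of the fibre product to the second relation. -/
def fiberSnd (R : Subgroup (G × H)) (T : Subgroup (H × K)) : fiberProduct R T →* H × K :=
  (MonoidHom.snd (G × H) (H × K)).comp (fiberProduct R T).subtype

/-- The projection of the fibre product to the product of relations. -/
def fiberComp (R : Subgroup (G × H)) (T : Subgroup (H × K)) : fiberProduct R T →* G × K :=
  ((MonoidHom.fst G H).comp (fiberFst R T)).prod ((MonoidHom.snd H K).comp (fiberSnd R T))

theorem range_fiberComp (R : Subgroup (G × H)) (T : Subgroup (H × K)) :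
    (fiberComp R T).range = comp T R := by
  ext ⟨g, k⟩
  constructor
  · rintro ⟨⟨⟨⟨g', h⟩, ⟨h', k'⟩⟩, h1, h2, h3⟩, hx⟩
    obtain ⟨rfl, rfl⟩ : g' = g ∧ k' = k := Prod.mk.injEq .. ▸ hx
    obtain rfl : h = h' := h3
    exact ⟨h, h1, h2⟩
  · rintro ⟨h, h1, h2⟩
    exact ⟨⟨((g, h), (h, k)), h1, h2, rfl⟩, rfl⟩

theorem range_fiberFst (R : Subgroup (G × H)) (T : Subgroup (H × K)) :
    (fiberFst R T).range = R ⊓ (⊤ : Subgroup G).prod (dom T) := by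
  ext ⟨g, h⟩
  constructor
  · rintro ⟨⟨⟨⟨g', h'⟩, ⟨h'', k'⟩⟩, h1, h2, h3⟩, hx⟩
    obtain ⟨rfl, rfl⟩ : g' = g ∧ h' = h := Prod.mk.injEq .. ▸ hx
    obtain rfl : h' = h'' := h3
    exact ⟨h1, trivial, mem_dom.2 ⟨_, h2⟩⟩
  · rintro ⟨h1, -, h2⟩
    obtain ⟨k, hk⟩ := mem_dom.1 h2
    exact ⟨⟨((g, h), (h, k)), h1, hk, rfl⟩, rfl⟩

theorem range_fiberSnd (R : Subgroup (G × H)) (T : Subgroup (H × K)) :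
    (fiberSnd R T).range = T ⊓ (im R).prod (⊤ : Subgroup K) := by
  ext ⟨h, k⟩
  constructor
  · rintro ⟨⟨⟨⟨g', h'⟩, ⟨h'', k'⟩⟩, h1, h2, h3⟩, hx⟩
    obtain ⟨rfl, rfl⟩ : h'' = h ∧ k' = k := Prod.mk.injEq .. ▸ hx
    obtain rfl : h' = h'' := h3
    exact ⟨h2, mem_im.2 ⟨_, h1⟩, trivial⟩
  · rintro ⟨h1, h2, -⟩
    obtain ⟨g, hg⟩ := mem_im.1 h2
    exact ⟨⟨((g, h), (h, k)), hg, h1, rfl⟩, rfl⟩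

theorem dom_inf_prod (R : Subgroup (G × H)) (T : Subgroup (H × K)) :
    dom (R ⊓ (⊤ : Subgroup G).prod (dom T)) = dom (comp T R) := by
  ext g
  simp only [mem_dom]
  constructor
  · rintro ⟨h, h1, -, h2⟩
    obtain ⟨k, hk⟩ := mem_dom.1 h2
    exact ⟨k, h, h1, hk⟩
  · rintro ⟨k, h, h1, h2⟩
    exact ⟨h, h1, trivial, mem_dom.2 ⟨k, h2⟩⟩

theorem im_inf_prod (R : Subgroup (G × H)) (T : Subgroup (H × K)) :
    im (T ⊓ (im R).prod (⊤ : Subgroup K)) = im (comp T R) := by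
  ext k
  simp only [mem_im]
  constructor
  · rintro ⟨h, h1, h2, -⟩
    obtain ⟨g, hg⟩ := mem_im.1 h2
    exact ⟨g, h, hg, h1⟩
  · rintro ⟨g, h, h1, h2⟩
    exact ⟨h, h2, mem_im.2 ⟨g, h1⟩, trivial⟩

end FiberProduct

/-! ### Existence of the normalized product -/

section Product

variable {G H K : Type*}
  [Group G] [TopologicalSpace G] [IsTopologicalGroup G] [T2Space G] [LocallyCompactSpace G]
  [SecondCountableTopology G] [MeasurableSpace G] [BorelSpace G]
  [Group H] [TopologicalSpace H] [IsTopologicalGroup H] [T2Space H] [LocallyCompactSpace H]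
  [SecondCountableTopology H] [MeasurableSpace H] [BorelSpace H]
  [Group K] [TopologicalSpace K] [IsTopologicalGroup K] [T2Space K] [LocallyCompactSpace K]
  [SecondCountableTopology K] [MeasurableSpace K] [BorelSpace K]
  {γ : Measure G} [γ.IsHaarMeasure] {η : Measure H} [η.IsHaarMeasure]
  {κ : Measure K} [κ.IsHaarMeasure]

/-- The image of a Haar measure under a proper homomorphism with open range. -/
theorem exists_map_eq_smul_restrict_of_isCompact_preimage {S : Type*} [Group S]
    [TopologicalSpace S] [IsTopologicalGroup S] [MeasurableSpace S] [BorelSpace S]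
    (γ : Measure G) [γ.IsHaarMeasure] (ρ : Measure S) [ρ.IsHaarMeasure]
    (f : S →* G) (hf : Continuous f) (hopen : IsOpen (f.range : Set G))
    (hprop : ∀ C : Set G, IsCompact C → IsCompact (f ⁻¹' C)) :
    ∃ a : ℝ≥0, a ≠ 0 ∧ ρ.map f = a • γ.restrict (f.range : Set G) := by
  have hemb : IsOpenEmbedding (f.range.subtype : f.range → G) := hopen.isOpenEmbedding_subtypeVal
  have : LocallyCompactSpace f.range := hopen.locallyCompactSpace
  have : SecondCountableTopology f.range :=
    inferInstanceAs (SecondCountableTopology (f.range : Set G))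
  have hmulG : MeasurableMul G := inferInstance
  have hHaar : (γ.comap f.range.subtype).IsHaarMeasure :=
    Measure.IsHaarMeasure.comap (mH := hmulG) γ hemb
  have hfr : Continuous f.rangeRestrict := hf.subtype_mk _
  have hval : (ρ.map f.rangeRestrict).map f.range.subtype = ρ.map f := by
    rw [Measure.map_map hemb.continuous.measurable hfr.measurable]
    rfl
  have hinv : (ρ.map f.rangeRestrict).IsMulLeftInvariant :=
    isMulLeftInvariant_map f.rangeRestrict.toMulHom hfr.measurable f.rangeRestrict_surjective
  have hfin : IsFiniteMeasureOnCompacts (ρ.map f.rangeRestrict) := by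
    refine ⟨fun C hC => ?_⟩
    have hC' := hC.image hemb.continuous
    rw [Measure.map_apply hfr.measurable hC.measurableSet]
    convert (hprop _ hC').measure_lt_top (μ := ρ) using 2
    ext x
    simp only [mem_preimage, mem_image]
    exact ⟨fun h => ⟨_, h, rfl⟩, fun ⟨y, hy, hyx⟩ => by
      rwa [show f.rangeRestrict x = y from Subtype.ext hyx.symm]⟩
  have h1 := Measure.isMulLeftInvariant_eq_smul (ρ.map f.rangeRestrict)
    (γ.comap f.range.subtype)
  have h2 := congrArg (Measure.map f.range.subtype) h1
  rw [hval, Measure.map_smul, hemb.measurableEmbedding.map_comap,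
    show Set.range f.range.subtype = (f.range : Set G) from Subtype.range_coe] at h2
  refine ⟨_, fun h0 => ?_, h2⟩
  rw [h0, zero_smul, Measure.map_eq_zero_iff hf.measurable.aemeasurable,
    ← Measure.measure_univ_eq_zero] at h2
  exact (isOpen_univ.measure_pos ρ univ_nonempty).ne' h2

/-- Corestricted to `R.rel`, the map `f` is a proper homomorphism with open range, so the image is
compared with the Haar measure of `R.rel` and then carried to `G × H`. -/
theorem Nonzero.exists_map_eq_smul_restrict {S : Type*} [Group S]
    [TopologicalSpace S] [IsTopologicalGroup S] [MeasurableSpace S] [BorelSpace S]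
    (R : Nonzero γ η) (ν : Measure S) [ν.IsHaarMeasure] (f : S →* G × H) (hf : Continuous f)
    {W : Subgroup (G × H)} (hW : IsOpen (W : Set (G × H))) (hrange : f.range = R.rel ⊓ W)
    (hprop : ∀ C : Set (G × H), IsCompact C → IsCompact (f ⁻¹' C)) :
    ∃ a : ℝ≥0, a ≠ 0 ∧ ν.map f = a • R.meas.restrict (W : Set (G × H)) := by
  obtain ⟨ρ, hρ, h⟩ := R.isHaar
  have hemb := R.isClosed_rel.isClosedEmbedding_subtypeVal
  have : LocallyCompactSpace R.rel := hemb.locallyCompactSpace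
  have : SecondCountableTopology R.rel :=
    inferInstanceAs (SecondCountableTopology (R.rel : Set (G × H)))
  have hfR : ∀ s, f s ∈ R.rel := fun s => (hrange.le ⟨s, rfl⟩).1
  let f' : S →* R.rel := f.codRestrict R.rel hfR
  have hf' : Continuous f' := hf.subtype_mk _
  have hr : (f'.range : Set R.rel) = Subtype.val ⁻¹' (W : Set (G × H)) := by
    ext x
    have h1 : (x : G × H) ∈ f.range ↔ (x : G × H) ∈ R.rel ⊓ W := by rw [hrange]
    simp only [Subgroup.mem_inf, x.2, true_and] at h1
    simp only [SetLike.mem_coe, mem_preimage, ← h1]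
    exact ⟨fun ⟨s, hs⟩ => ⟨s, congrArg Subtype.val hs⟩, fun ⟨s, hs⟩ => ⟨s, Subtype.ext hs⟩⟩
  obtain ⟨a, ha, hmap⟩ := exists_map_eq_smul_restrict_of_isCompact_preimage ρ ν f' hf'
    (by rw [hr]; exact hW.preimage continuous_subtype_val)
    (fun C hC => by
      convert hprop _ (hC.image hemb.continuous) using 1
      ext x
      simp only [mem_preimage, mem_image]
      exact ⟨fun h => ⟨_, h, rfl⟩, fun ⟨y, hy, hyx⟩ => by
        rwa [show f' x = y from Subtype.ext hyx.symm]⟩)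
  refine ⟨a, ha, ?_⟩
  have h2 := congrArg (Measure.map (Subtype.val : R.rel → G × H)) hmap
  rw [Measure.map_map measurable_subtype_coe hf'.measurable, Measure.map_smul, hr,
    ← Measure.restrict_map measurable_subtype_coe hW.measurableSet, ← h] at h2
  exact h2

theorem Nonzero.map_snd_restrict (R : Nonzero γ η) {W : Subgroup (G × H)}
    (hW : IsOpen (W : Set (G × H))) :
    (R.meas.restrict W).map Prod.snd =
      (R.beta / ((W.comap (MonoidHom.inl G H)).relIndex (ker R.rel) : ℕ)) •
        η.restrict (im (R.rel ⊓ W) : Set H) := by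
  let W' : Subgroup (H × G) := W.comap (MulEquiv.prodComm : H × G ≃* G × H).toMonoidHom
  have hW' : IsOpen (W' : Set (H × G)) := hW.preimage continuous_swap
  have h := R.swap.map_fst_restrict hW'
  have h1 : (R.swap.meas.restrict W').map Prod.fst = (R.meas.restrict W).map Prod.snd := by
    have : (W' : Set (H × G)) = Prod.swap ⁻¹' W := rfl
    rw [this]
    change ((R.meas.map Prod.swap).restrict _).map _ = _
    rw [Measure.restrict_map measurable_swap (measurable_swap hW.measurableSet),
      Measure.map_map measurable_fst measurable_swap]
    rfl
  have h2 : dom (R.swap.rel ⊓ W') = im (R.rel ⊓ W) := by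
    ext x
    simp only [mem_dom, mem_im]
    rfl
  rw [h1, h2, R.alpha_swap] at h
  exact h

theorem continuous_fiberFst (R : Subgroup (G × H)) (T : Subgroup (H × K)) :
    Continuous (fiberFst R T) := continuous_fst.comp continuous_subtype_val

theorem continuous_fiberSnd (R : Subgroup (G × H)) (T : Subgroup (H × K)) :
    Continuous (fiberSnd R T) := continuous_snd.comp continuous_subtype_val

theorem continuous_fiberComp (R : Subgroup (G × H)) (T : Subgroup (H × K)) :
    Continuous (fiberComp R T) :=
  (continuous_fst.comp (continuous_fiberFst R T)).prodMk
    (continuous_snd.comp (continuous_fiberSnd R T))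

namespace Nonzero

variable (R : Nonzero γ η) (T : Nonzero η κ)

theorem isClosed_fiberProduct :
    IsClosed (fiberProduct R.rel T.rel : Set ((G × H) × (H × K))) :=
  (R.isClosed_rel.preimage continuous_fst).inter ((T.isClosed_rel.preimage continuous_snd).inter
    (isClosed_eq (continuous_snd.comp continuous_fst) (continuous_fst.comp continuous_snd)))

theorem isCompact_preimage_fiber {C : Set (G × H)} {D : Set (H × K)} (hC : IsCompact C)
    (hD : IsCompact D) {A : Set (fiberProduct R.rel T.rel)} (hA : IsClosed A)
    (h1 : ∀ x ∈ A, x.1.1 ∈ C) (h2 : ∀ x ∈ A, x.1.2 ∈ D) : IsCompact A :=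
  ((R.isClosed_fiberProduct T).isClosedEmbedding_subtypeVal.isCompact_preimage
    (hC.prod hD)).of_isClosed_subset hA fun x hx => ⟨h1 x hx, h2 x hx⟩

theorem isCompact_preimage_fiberFst {C : Set (G × H)} (hC : IsCompact C) :
    IsCompact (fiberFst R.rel T.rel ⁻¹' C) :=
  R.isCompact_preimage_fiber T hC (T.isCompact_inter_fst (hC.image continuous_snd))
    (hC.isClosed.preimage (continuous_fiberFst _ _)) (fun _ hx => hx)
    fun x hx => ⟨x.2.2.1, x.1.1, hx, x.2.2.2⟩

theorem isCompact_preimage_fiberSnd {C : Set (H × K)} (hC : IsCompact C) :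
    IsCompact (fiberSnd R.rel T.rel ⁻¹' C) :=
  R.isCompact_preimage_fiber T (R.isCompact_inter_snd (hC.image continuous_fst)) hC
    (hC.isClosed.preimage (continuous_fiberSnd _ _))
    (fun x hx => ⟨x.2.1, x.1.2, hx, x.2.2.2.symm⟩) fun _ hx => hx

theorem isCompact_preimage_fiberComp {C : Set (G × K)} (hC : IsCompact C) :
    IsCompact (fiberComp R.rel T.rel ⁻¹' C) :=
  R.isCompact_preimage_fiber T (R.isCompact_inter_fst (hC.image continuous_fst))
    (T.isCompact_inter_snd (hC.image continuous_snd))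
    (hC.isClosed.preimage (continuous_fiberComp _ _))
    (fun x hx => ⟨x.2.1, _, hx, rfl⟩) fun x hx => ⟨x.2.2.1, _, hx, rfl⟩

/-- The product is the range of a proper map: bounding the outer coordinates bounds the middle one,
by properness of `R → G` and `T → K`. -/
theorem isClosed_comp : IsClosed (comp T.rel R.rel : Set (G × K)) := by
  have h : IsProperMap (fiberComp R.rel T.rel) :=
    isProperMap_iff_isCompact_preimage.2
      ⟨continuous_fiberComp _ _, fun _ hC => R.isCompact_preimage_fiberComp T hC⟩
  rw [← range_fiberComp]
  exact h.isClosedMap.isClosed_range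

/-- The Haar measure of the fibre product compatible with the measures of both relations. -/
theorem exists_fiber_measure : ∃ ν : Measure (fiberProduct R.rel T.rel), ν.IsHaarMeasure ∧
    ν.map (fiberFst R.rel T.rel) =
      T.alpha • R.meas.restrict ((⊤ : Subgroup G).prod (dom T.rel) : Set (G × H)) ∧
    ν.map (fiberSnd R.rel T.rel) =
      R.beta • T.meas.restrict ((im R.rel).prod (⊤ : Subgroup K) : Set (H × K)) := by
  have : LocallyCompactSpace (fiberProduct R.rel T.rel) :=
    (R.isClosed_fiberProduct T).isClosedEmbedding_subtypeVal.locallyCompactSpace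
  let ν : Measure (fiberProduct R.rel T.rel) := Measure.haar
  have hW1 : IsOpen ((⊤ : Subgroup G).prod (dom T.rel) : Set (G × H)) :=
    isOpen_univ.prod T.isOpen_dom
  have hW2 : IsOpen ((im R.rel).prod (⊤ : Subgroup K) : Set (H × K)) :=
    R.isOpen_im.prod isOpen_univ
  obtain ⟨a, ha, h1⟩ := R.exists_map_eq_smul_restrict ν (fiberFst R.rel T.rel)
    (continuous_fiberFst _ _) hW1 (range_fiberFst _ _)
    fun _ hC => R.isCompact_preimage_fiberFst T hC
  obtain ⟨b, hb, h2⟩ := T.exists_map_eq_smul_restrict ν (fiberSnd R.rel T.rel)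
    (continuous_fiberSnd _ _) hW2 (range_fiberSnd _ _)
    fun _ hC => R.isCompact_preimage_fiberSnd T hC
  -- Both images have the same projection to `H`, so their coefficients there agree on `dom T ∩ im
  -- R`.
  have hab : a * R.beta = b * T.alpha := by
    refine smul_restrict_injective η (T.isOpen_dom.inter R.isOpen_im) ⟨1, one_mem _, one_mem _⟩ ?_
    have h3 : (ν.map (fiberFst R.rel T.rel)).map Prod.snd =
        (ν.map (fiberSnd R.rel T.rel)).map Prod.fst := by
      rw [Measure.map_map measurable_snd (continuous_fiberFst _ _).measurable,
        Measure.map_map measurable_fst (continuous_fiberSnd _ _).measurable]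
      congr 1
      ext x
      exact x.2.2.2
    have e1 : ((⊤ : Subgroup G).prod (dom T.rel) : Set (G × H)) =
        Prod.snd ⁻¹' (dom T.rel : Set H) := by
      ext; simp [Subgroup.mem_prod]
    have e2 : ((im R.rel).prod (⊤ : Subgroup K) : Set (H × K)) =
        Prod.fst ⁻¹' (im R.rel : Set H) := by
      ext; simp [Subgroup.mem_prod]
    rw [h1, h2, Measure.map_smul, Measure.map_smul, e1, e2,
      ← Measure.restrict_map measurable_snd T.isOpen_dom.measurableSet,
      ← Measure.restrict_map measurable_fst R.isOpen_im.measurableSet,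
      R.map_snd_meas, T.map_fst_meas, Measure.restrict_smul, Measure.restrict_smul,
      Measure.restrict_restrict T.isOpen_dom.measurableSet,
      Measure.restrict_restrict R.isOpen_im.measurableSet, smul_smul, smul_smul,
      inter_comm (im R.rel : Set H)] at h3
    exact h3
  -- Rescaling by `T.alpha / a` makes the first coefficient `T.alpha`; by `hab` the second becomes
  -- `R.beta`.
  have hc : T.alpha / a ≠ 0 := div_ne_zero T.alpha_ne_zero ha
  refine ⟨(T.alpha / a) • ν, Measure.IsHaarMeasure.nnreal_smul _ hc, ?_, ?_⟩
  · rw [Measure.map_smul, h1, smul_smul, div_mul_cancel₀ _ ha]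
  · rw [Measure.map_smul, h2, smul_smul]
    congr 1
    rw [div_mul_eq_mul_div, mul_comm, ← hab, mul_div_cancel_left₀ _ ha]

theorem smul_restrict_le {c : ℝ≥0} (hc : c ≤ 1) (m : Measure G) (s : Set G) :
    c • m.restrict s ≤ m := by
  refine Measure.le_iff.2 fun A _ => ?_
  rw [Measure.smul_apply, ENNReal.smul_def, smul_eq_mul]
  calc (c : ℝ≥0∞) * m.restrict s A ≤ 1 * m.restrict s A := by gcongr; exact_mod_cast hc
    _ ≤ m A := by rw [one_mul]; exact Measure.restrict_apply_le _ _

theorem _root_.NNReal.mul_mul_div_natCast_le_one {a b : ℝ≥0} (ha : a ≤ 1) (hb : b ≤ 1) (n : ℕ) :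
    a * b / n ≤ 1 := by
  rcases Nat.eq_zero_or_pos n with rfl | hn
  · simp
  · refine div_le_one_of_le₀ ((mul_le_one' ha hb).trans ?_) (by positivity)
    exact_mod_cast hn

/-- The image of the fibre measure in `G × K` works. Its projection to `G` factors through `R`
restricted to second coordinates in `dom T`, and its projection to `K` through `T` restricted to
first coordinates in `im R`; each restriction contributes one of the two indices. -/
theorem exists_isProduct :
    ∃ S : Nonzero γ κ, IsProduct (.ofNonzero T) (.ofNonzero R) (.ofNonzero S) := by
  obtain ⟨ν, hν, h1, h2⟩ := R.exists_fiber_measure T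
  have hp := (continuous_fiberComp R.rel T.rel).measurable
  have hW1 : IsOpen ((⊤ : Subgroup G).prod (dom T.rel) : Set (G × H)) :=
    isOpen_univ.prod T.isOpen_dom
  have hW2 : IsOpen ((im R.rel).prod (⊤ : Subgroup K) : Set (H × K)) :=
    R.isOpen_im.prod isOpen_univ
  have hfst : (ν.map (fiberComp R.rel T.rel)).map Prod.fst =
      (R.alpha * T.alpha / ((indef R.rel ⊓ dom T.rel).relIndex (indef R.rel) : ℕ)) •
        γ.restrict (dom (comp T.rel R.rel) : Set G) := by
    have h3 : (ν.map (fiberComp R.rel T.rel)).map Prod.fst =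
        (ν.map (fiberFst R.rel T.rel)).map Prod.fst := by
      rw [Measure.map_map measurable_fst hp,
        Measure.map_map measurable_fst (continuous_fiberFst _ _).measurable]
      rfl
    have h4 : ((⊤ : Subgroup G).prod (dom T.rel)).comap (MonoidHom.inr G H) = dom T.rel := by
      ext; simp [Subgroup.mem_prod]
    rw [h3, h1, Measure.map_smul, R.map_fst_restrict hW1, smul_smul, h4, dom_inf_prod,
      Subgroup.inf_relIndex_left, mul_div_assoc', mul_comm]
  have hsnd : (ν.map (fiberComp R.rel T.rel)).map Prod.snd =
      (R.beta * T.beta / ((ker T.rel ⊓ im R.rel).relIndex (ker T.rel) : ℕ)) •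
        κ.restrict (im (comp T.rel R.rel) : Set K) := by
    have h3 : (ν.map (fiberComp R.rel T.rel)).map Prod.snd =
        (ν.map (fiberSnd R.rel T.rel)).map Prod.snd := by
      rw [Measure.map_map measurable_snd hp,
        Measure.map_map measurable_snd (continuous_fiberSnd _ _).measurable]
      rfl
    have h4 : ((im R.rel).prod (⊤ : Subgroup K)).comap (MonoidHom.inl H K) = im R.rel := by
      ext; simp [Subgroup.mem_prod]
    rw [h3, h2, Measure.map_smul, T.map_snd_restrict hW2, smul_smul, h4, im_inf_prod,
      Subgroup.inf_relIndex_left, mul_div_assoc']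
  have hfst_le : (ν.map (fiberComp R.rel T.rel)).map Prod.fst ≤ γ := by
    rw [hfst]
    exact smul_restrict_le (NNReal.mul_mul_div_natCast_le_one R.alpha_le_one T.alpha_le_one _) _ _
  have hsnd_le : (ν.map (fiberComp R.rel T.rel)).map Prod.snd ≤ κ := by
    rw [hsnd]
    exact smul_restrict_le (NNReal.mul_mul_div_natCast_le_one R.beta_le_one T.beta_le_one _) _ _
  have hfin := isFiniteMeasureOnCompacts_of_map_fst_le hfst_le
  have hcl := R.isClosed_comp T
  have hrange := range_fiberComp R.rel T.rel
  let S : Nonzero γ κ :=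
    { rel := comp T.rel R.rel
      meas := ν.map (fiberComp R.rel T.rel)
      isClosed_rel := hcl
      isHaar := by
        refine exists_haar_of_invariant hcl _ ?_ ?_ ?_
        · rw [Ne, Measure.map_eq_zero_iff hp.aemeasurable, ← Measure.measure_univ_eq_zero]
          exact (isOpen_univ.measure_pos ν univ_nonempty).ne'
        · rw [Measure.map_apply hp hcl.measurableSet.compl]
          convert measure_empty (μ := ν)
          refine eq_empty_of_forall_notMem fun x hx => hx ?_
          rw [← hrange]
          exact ⟨x, rfl⟩
        · intro x hx
          rw [← hrange] at hx
          obtain ⟨y, rfl⟩ := hx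
          have hc : (fiberComp R.rel T.rel y * ·) ∘ fiberComp R.rel T.rel =
              fiberComp R.rel T.rel ∘ (y * ·) := by
            ext z <;> simp
          rw [Measure.map_map (measurable_const_mul _) hp, hc,
            ← Measure.map_map hp (measurable_const_mul _), map_mul_left_eq_self]
      map_fst_le := hfst_le
      map_snd_le := hsnd_le }
  exact ⟨S, rfl, S.alpha_eq_of_map_fst hfst, S.beta_eq_of_map_snd hsnd⟩

end Nonzero

end Product

/-! ### Index identities behind associativity -/

section Index

theorem relIndex_eq_of_forall_mul {G : Type*} [Group G] {L K D : Subgroup G} (hLK : L ≤ K)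
    (h : ∀ x ∈ K, ∃ l ∈ L, ∃ d ∈ D, x = l * d) : D.relIndex L = D.relIndex K := by
  refine Nat.card_eq_of_bijective (Subgroup.quotientSubgroupOfEmbeddingOfLE D hLK)
    ⟨(Subgroup.quotientSubgroupOfEmbeddingOfLE D hLK).injective, fun q => ?_⟩
  obtain ⟨⟨x, hx⟩, rfl⟩ := QuotientGroup.mk_surjective q
  obtain ⟨l, hl, d, hd, rfl⟩ := h x hx
  refine ⟨QuotientGroup.mk ⟨l, hl⟩, ?_⟩
  rw [Subgroup.quotientSubgroupOfEmbeddingOfLE_apply_mk, QuotientGroup.eq,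
    Subgroup.mem_subgroupOf]
  simpa using hd

/-- Split the index at `E ⊔ f.ker`. Infinite indices count as `0`, and the identity remains valid.
-/
theorem index_eq_relIndex_ker_mul {P Q : Type*} [Group P] [Group Q] (f : P →* Q)
    (E : Subgroup P) : E.index = E.relIndex f.ker * (E.map f).relIndex f.range := by
  have h1 : (E.map f).relIndex f.range = (E ⊔ f.ker).index := by
    rw [MonoidHom.range_eq_map, ← Subgroup.relIndex_comap, Subgroup.comap_map_eq,
      Subgroup.relIndex_top_right]
  have h2 : E.relIndex f.ker = E.relIndex (E ⊔ f.ker) := by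
    refine relIndex_eq_of_forall_mul le_sup_right fun x hx => ?_
    rw [sup_comm, ← SetLike.mem_coe, Subgroup.normal_mul] at hx
    obtain ⟨l, hl, d, hd, rfl⟩ := hx
    exact ⟨l, hl, d, hd, rfl⟩
  rw [h1, h2, Subgroup.relIndex_mul_index le_sup_left]

/-- Let `X` be the part of `T` over `indef R`, and take the index in `X` of the pairs with second
coordinate in `dom U`. Projected to `K`, it is the index in `indef (comp T R)`; projected to `H`, it
splits into a kernel part `indef T` and an image part `indef R ⊓ dom T`. -/
theorem relIndex_mul_relIndex_comp {G H K L : Type*} [Group G] [Group H] [Group K] [Group L]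
    (R : Subgroup (G × H)) (T : Subgroup (H × K)) (U : Subgroup (K × L)) :
    (dom T).relIndex (indef R) * (dom U).relIndex (indef (comp T R)) =
      (dom U).relIndex (indef T) * (dom (comp U T)).relIndex (indef R) := by
  let X : Subgroup (H × K) := T ⊓ (indef R).prod ⊤
  let p : X →* H := (MonoidHom.fst H K).comp X.subtype
  let q : X →* K := (MonoidHom.snd H K).comp X.subtype
  have hX : ∀ {h k}, (h, k) ∈ X ↔ (h, k) ∈ T ∧ (1, h) ∈ R := by
    intro h k
    simp only [X, Subgroup.mem_inf, Subgroup.mem_prod, Subgroup.mem_top, and_true, mem_indef]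
  have e1 : q.range = indef (comp T R) := by
    ext k
    constructor
    · rintro ⟨⟨⟨h, k'⟩, hx⟩, rfl⟩
      exact ⟨h, (hX.1 hx).2, (hX.1 hx).1⟩
    · rintro ⟨h, h1, h2⟩
      exact ⟨⟨(h, k), hX.2 ⟨h2, h1⟩⟩, rfl⟩
  have e2 : p.ker.map q = indef T := by
    ext k
    constructor
    · rintro ⟨⟨⟨h, k'⟩, hx⟩, hp, rfl⟩
      obtain rfl : h = 1 := hp
      exact (hX.1 hx).1
    · intro hk
      exact ⟨⟨(1, k), hX.2 ⟨hk, R.one_mem⟩⟩, rfl, rfl⟩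
  have e3 : p.range = indef R ⊓ dom T := by
    ext h
    constructor
    · rintro ⟨⟨⟨h', k⟩, hx⟩, rfl⟩
      exact ⟨(hX.1 hx).2, ⟨_, (hX.1 hx).1, rfl⟩⟩
    · rintro ⟨h1, ⟨⟨h', k⟩, h2, rfl⟩⟩
      exact ⟨⟨(h', k), hX.2 ⟨h2, h1⟩⟩, rfl⟩
  have e4 : ((dom U).comap q).map p = indef R ⊓ dom (comp U T) := by
    ext h
    constructor
    · rintro ⟨⟨⟨h', k⟩, hx⟩, ⟨⟨k', l⟩, hU, hk⟩, rfl⟩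
      obtain rfl : k' = k := hk
      exact ⟨(hX.1 hx).2, ⟨(h', l), ⟨k', (hX.1 hx).1, hU⟩, rfl⟩⟩
    · rintro ⟨h1, ⟨⟨h', l⟩, ⟨k, h2, h3⟩, rfl⟩⟩
      exact ⟨⟨(h', k), hX.2 ⟨h2, h1⟩⟩, ⟨(k, l), h3, rfl⟩, rfl⟩
  have e5 : dom (comp U T) ≤ dom T := by
    rintro _ ⟨⟨h, l⟩, ⟨k, h1, -⟩, rfl⟩
    exact ⟨(h, k), h1, rfl⟩
  have h1 := index_eq_relIndex_ker_mul p ((dom U).comap q)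
  rw [Subgroup.index_comap, Subgroup.relIndex_comap, e1, e2, e3, e4] at h1
  have h2 : (indef R ⊓ dom (comp U T)).relIndex (indef R ⊓ dom T) * (dom T).relIndex (indef R) =
      (dom (comp U T)).relIndex (indef R) := by
    rw [← Subgroup.inf_relIndex_left (indef R) (dom T),
      Subgroup.relIndex_mul_relIndex _ _ _ (inf_le_inf_left _ e5) inf_le_left,
      Subgroup.inf_relIndex_left]
  rw [h1, ← h2]
  ring

theorem comp_assoc {G H K L : Type*} [Group G] [Group H] [Group K] [Group L]
    (R : Subgroup (G × H)) (T : Subgroup (H × K)) (U : Subgroup (K × L)) :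
    comp (comp U T) R = comp U (comp T R) := by
  ext ⟨g, l⟩
  constructor
  · rintro ⟨h, h1, k, h2, h3⟩
    exact ⟨k, ⟨h, h1, h2⟩, h3⟩
  · rintro ⟨k, ⟨h, h1, h2⟩, h3⟩
    exact ⟨h, h1, k, h2, h3⟩

end Index

/-! ### Indices of open subgroups in compact subgroups -/

section IndexSemigroup

variable {G : Type*} [Group G] [TopologicalSpace G] [IsTopologicalGroup G]

/-- Intersect all conjugates of `U` by elements of `L`; compactness of `L` keeps the intersection
open. -/
theorem exists_open_le_normalized {L U : Subgroup G} (hL : IsCompact (L : Set G))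
    (hU : IsOpen (U : Set G)) :
    ∃ N : Subgroup G, IsOpen (N : Set G) ∧ N ≤ U ∧ ∀ l ∈ L, ∀ n ∈ N, l * n * l⁻¹ ∈ N := by
  let N : Subgroup G :=
    { carrier := {g | ∀ l ∈ L, l * g * l⁻¹ ∈ U}
      one_mem' := fun l _ => by simp
      mul_mem' := fun {x y} hx hy l hl => by
        have := U.mul_mem (hx l hl) (hy l hl)
        simpa [mul_assoc] using this
      inv_mem' := fun {x} hx l hl => by
        have := U.inv_mem (hx l hl)
        simpa [mul_assoc] using this }
  refine ⟨N, ?_, fun x hx => by simpa using hx 1 L.one_mem, fun l hl n hn l' hl' => ?_⟩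
  · refine N.isOpen_of_mem_nhds (g := 1) ?_
    refine hL.eventually_forall_of_forall_eventually (P := fun g l => l * g * l⁻¹ ∈ U)
      fun l _ => ?_
    have hc : Continuous fun z : G × G => z.2 * z.1 * z.2⁻¹ := by fun_prop
    exact hc.continuousAt.preimage_mem_nhds (hU.mem_nhds (by simp))
  · have := hn (l' * l) (L.mul_mem hl' hl)
    simpa [mul_assoc] using this

/-- A compact subgroup is contained in a compact open subgroup, which can be chosen inside its
product with a given open subgroup. -/
theorem exists_compact_open_ge {L D K₀ : Subgroup G} (hL : IsCompact (L : Set G))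
    (hD : IsOpen (D : Set G)) (hc : IsCompact (K₀ : Set G)) (ho : IsOpen (K₀ : Set G)) :
    ∃ K : Subgroup G, IsCompact (K : Set G) ∧ IsOpen (K : Set G) ∧ L ≤ K ∧
      ∀ x ∈ K, ∃ l ∈ L, ∃ d ∈ D, x = l * d := by
  obtain ⟨N, hNo, hNU, hN⟩ := exists_open_le_normalized (U := D ⊓ K₀) hL (hD.inter ho)
  have hNc : IsCompact (N : Set G) :=
    hc.of_isClosed_subset (N.isClosed_of_isOpen hNo) (hNU.trans inf_le_right)
  let K : Subgroup G :=
    { carrier := (L : Set G) * N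
      one_mem' := ⟨1, L.one_mem, 1, N.one_mem, by simp⟩
      mul_mem' := by
        rintro _ _ ⟨l, hl, n, hn, rfl⟩ ⟨l', hl', n', hn', rfl⟩
        refine ⟨l * l', L.mul_mem hl hl', (l'⁻¹ * n * l'⁻¹⁻¹) * n',
          N.mul_mem (hN _ (L.inv_mem hl') _ hn) hn', ?_⟩
        simp [mul_assoc]
      inv_mem' := by
        rintro _ ⟨l, hl, n, hn, rfl⟩
        exact ⟨l⁻¹, L.inv_mem hl, l * n⁻¹ * l⁻¹, hN l hl _ (N.inv_mem hn), by simp [mul_assoc]⟩ }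
  refine ⟨K, hL.mul hNc, hNo.mul_left, fun l hl => ⟨l, hl, 1, N.one_mem, by simp⟩, ?_⟩
  rintro _ ⟨l, hl, n, hn, rfl⟩
  exact ⟨l, hl, n, (hNU hn).1, rfl⟩

/-- Enlarging `L` to a compact open `K ⊆ L * D` creates no new cosets of `D`, so the index is that
of `K ⊓ D` in `K`. -/
theorem relIndex_mem_indexSemigroup {L D K₀ : Subgroup G} (hL : IsCompact (L : Set G))
    (hD : IsOpen (D : Set G)) (hc : IsCompact (K₀ : Set G)) (ho : IsOpen (K₀ : Set G)) :
    D.relIndex L ∈ indexSemigroup G := by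
  obtain ⟨K, hKc, hKo, hLK, hK⟩ := exists_compact_open_ge hL hD hc ho
  refine Subsemigroup.subset_closure ⟨K, K ⊓ D, hKc, hKo,
    hKc.of_isClosed_subset (Subgroup.isClosed_of_isOpen _ (hKo.inter hD)) inter_subset_left,
    hKo.inter hD, inf_le_left, ?_⟩
  rw [Subgroup.inf_relIndex_left, relIndex_eq_of_forall_mul hLK hK]

end IndexSemigroup

/-! ### Uniqueness and associativity of the product; stability of the set given by `Λ` -/

section Semigroup

variable {G H K : Type*}
  [Group G] [TopologicalSpace G] [IsTopologicalGroup G] [T2Space G] [LocallyCompactSpace G]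
  [SecondCountableTopology G] [MeasurableSpace G] [BorelSpace G]
  [Group H] [TopologicalSpace H] [IsTopologicalGroup H] [T2Space H] [LocallyCompactSpace H]
  [SecondCountableTopology H] [MeasurableSpace H] [BorelSpace H]
  [Group K] [TopologicalSpace K] [IsTopologicalGroup K] [T2Space K] [LocallyCompactSpace K]
  [SecondCountableTopology K] [MeasurableSpace K] [BorelSpace K]
  {γ : Measure G} [γ.IsHaarMeasure] {η : Measure H} [η.IsHaarMeasure]
  {κ : Measure K} [κ.IsHaarMeasure]

/-- The product of nonzero polyhomomorphisms. -/
noncomputable def Nonzero.prod (T : Nonzero η κ) (R : Nonzero γ η) : Nonzero γ κ :=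
  (R.exists_isProduct T).choose

theorem Nonzero.isProduct_prod (T : Nonzero η κ) (R : Nonzero γ η) :
    IsProduct (.ofNonzero T) (.ofNonzero R) (.ofNonzero (T.prod R)) :=
  (R.exists_isProduct T).choose_spec

theorem Nonzero.rel_prod (T : Nonzero η κ) (R : Nonzero γ η) :
    (T.prod R).rel = comp T.rel R.rel := (T.isProduct_prod R).1

theorem Nonzero.alpha_prod (T : Nonzero η κ) (R : Nonzero γ η) :
    (T.prod R).alpha = R.alpha * T.alpha / ((dom T.rel).relIndex (indef R.rel) : ℕ) := by
  rw [(T.isProduct_prod R).2.1, Subgroup.inf_relIndex_left]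

theorem Nonzero.beta_prod (T : Nonzero η κ) (R : Nonzero γ η) :
    (T.prod R).beta = R.beta * T.beta / ((im R.rel).relIndex (ker T.rel) : ℕ) := by
  rw [(T.isProduct_prod R).2.2, Subgroup.inf_relIndex_left]

/-- The product of polyhomomorphisms. -/
noncomputable def Polh.prod : Polh η κ → Polh γ η → Polh γ κ
  | .ofNonzero T, .ofNonzero R => .ofNonzero (T.prod R)
  | .zero, _ => .zero
  | .ofNonzero _, .zero => .zero

theorem isProduct_iff (T : Polh η κ) (R : Polh γ η) (S : Polh γ κ) :
    IsProduct T R S ↔ S = T.prod R := by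
  rcases T with _ | T
  · exact Iff.rfl
  rcases R with _ | R
  · exact Iff.rfl
  rcases S with _ | S
  · exact ⟨False.elim, fun h => by cases h⟩
  have h := T.isProduct_prod R
  constructor
  · intro h'
    exact congrArg _ (Nonzero.ext_of_alpha (h'.1.trans h.1.symm) (h'.2.1.trans h.2.1.symm))
  · intro h'
    rw [h']
    exact h

theorem Nonzero.prod_assoc {L : Type*} [Group L] [TopologicalSpace L] [IsTopologicalGroup L]
    [T2Space L] [LocallyCompactSpace L] [SecondCountableTopology L] [MeasurableSpace L]
    [BorelSpace L] {ν : Measure L} [ν.IsHaarMeasure]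
    (U : Nonzero κ ν) (T : Nonzero η κ) (R : Nonzero γ η) :
    (U.prod T).prod R = U.prod (T.prod R) := by
  refine Nonzero.ext_of_alpha ?_ ?_
  · simp only [Nonzero.rel_prod, comp_assoc]
  -- Only `α` has to be compared, since with the relation it determines the measure and hence `β`.
  · have h := relIndex_mul_relIndex_comp R.rel T.rel U.rel
    have h' := congrArg (Nat.cast : ℕ → ℝ≥0) h
    push_cast at h'
    simp only [Nonzero.alpha_prod, Nonzero.rel_prod, mul_div_assoc', div_mul_eq_mul_div, div_div]
    rw [h', mul_assoc]

/-- The semigroup of polyendomorphisms. -/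
noncomputable abbrev polhSemigroup (γ : Measure G) [γ.IsHaarMeasure] : Semigroup (Polh γ γ) where
  mul T R := T.prod R
  mul_assoc U T R := by
    change (U.prod T).prod R = U.prod (T.prod R)
    rcases U with _ | U
    · rfl
    rcases T with _ | T
    · rfl
    rcases R with _ | R
    · rfl
    exact congrArg _ (U.prod_assoc T R)

theorem prod_mem_polhΛ {K₀ : Subgroup G} (hc : IsCompact (K₀ : Set G)) (ho : IsOpen (K₀ : Set G))
    {T R : Polh γ γ} (hT : T ∈ polhΛ γ) (hR : R ∈ polhΛ γ) : T.prod R ∈ polhΛ γ := by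
  rcases hT with rfl | ⟨T, rfl, ⟨n, hn, hTa⟩, m, hm, hTb⟩
  · exact Or.inl rfl
  rcases hR with rfl | ⟨R, rfl, ⟨n', hn', hRa⟩, m', hm', hRb⟩
  · exact Or.inl rfl
  refine Or.inr ⟨_, rfl, ⟨_, mul_mem (mul_mem hn hn')
    (relIndex_mem_indexSemigroup R.isCompact_indef T.isOpen_dom hc ho), ?_⟩,
    ⟨_, mul_mem (mul_mem hm hm') (relIndex_mem_indexSemigroup
      (T.swap.isCompact_indef) R.isOpen_im hc ho), ?_⟩⟩
  · rw [Nonzero.alpha_prod, inv_div, Nat.cast_mul, Nat.cast_mul, ← hTa, ← hRa, div_eq_mul_inv,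
      mul_inv]
    ring
  · rw [Nonzero.beta_prod, inv_div, Nat.cast_mul, Nat.cast_mul, ← hTb, ← hRb, div_eq_mul_inv,
      mul_inv, T.indef_swap]
    ring

end Semigroup

/-! ### Vague limits of measures -/

section VagueLimit

variable {X : Type*} [TopologicalSpace X] [T2Space X] [LocallyCompactSpace X]
  [MeasurableSpace X] [BorelSpace X]

/-- One Urysohn function serves every measure `m`, so bounds on masses pass to the limit through its
integrals. -/
theorem exists_compactlySupported_between {C U : Set X} (hC : IsCompact C) (hU : IsOpen U)
    (hCU : C ⊆ U) : ∃ f : C_c(X, ℝ), ∀ m : Measure X, IsFiniteMeasureOnCompacts m →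
      m C ≤ ENNReal.ofReal (∫ x, f x ∂m) ∧ ENNReal.ofReal (∫ x, f x ∂m) ≤ m U := by
  obtain ⟨f, hf1, hfc, hfU, hf⟩ := exists_continuousMap_one_of_isCompact_subset_isOpen hC hU hCU
  refine ⟨⟨f, hfc⟩, fun m hm => ?_⟩
  have hint : Integrable f m := f.continuous.integrable_of_hasCompactSupport hfc
  change m C ≤ ENNReal.ofReal (∫ x, f x ∂m) ∧ ENNReal.ofReal (∫ x, f x ∂m) ≤ m U
  rw [ofReal_integral_eq_lintegral_ofReal hint (ae_of_all _ fun x => (hf x).1),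
    ← lintegral_indicator_one hC.measurableSet, ← lintegral_indicator_one hU.measurableSet]
  refine ⟨lintegral_mono fun x => ?_, lintegral_mono fun x => ?_⟩
  · by_cases hx : x ∈ C
    · simp [hx, hf1 hx]
    · simp [hx]
  · by_cases hx : x ∈ U
    · simpa [hx] using (hf x).2
    · have : f x = 0 := image_eq_zero_of_notMem_tsupport fun h => hx (hfU h)
      simp [hx, this]

variable {ι : Type*} {m : ι → Measure X} [∀ i, IsFiniteMeasureOnCompacts (m i)]
  {μ : Measure X} [μ.Regular] {F : Filter ι}

theorem measure_le_of_vague_limit [F.NeBot]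
    (hlim : ∀ f : C_c(X, ℝ), Tendsto (fun i => ∫ x, f x ∂(m i)) F (𝓝 (∫ x, f x ∂μ)))
    {W : Set X} (hW : IsOpen W) {c : ℝ≥0∞} (h : ∀ᶠ i in F, m i W ≤ c) : μ W ≤ c := by
  rw [hW.measure_eq_iSup_isCompact]
  refine iSup₂_le fun C hCW => iSup_le fun hC => ?_
  obtain ⟨f, hf⟩ := exists_compactlySupported_between hC hW hCW
  refine (hf μ inferInstance).1.trans
    (le_of_tendsto ((ENNReal.continuous_ofReal.tendsto _).comp (hlim f)) ?_)
  filter_upwards [h] with i hi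
  exact (hf (m i) inferInstance).2.trans hi

theorem eventually_measure_lt_of_vague_limit
    (hlim : ∀ f : C_c(X, ℝ), Tendsto (fun i => ∫ x, f x ∂(m i)) F (𝓝 (∫ x, f x ∂μ)))
    {C : Set X} (hC : IsCompact C) {c : ℝ≥0∞} (h : μ C < c) : ∀ᶠ i in F, m i C < c := by
  obtain ⟨U, hCU, hU, hUc⟩ := C.exists_isOpen_lt_of_lt c h
  obtain ⟨f, hf⟩ := exists_compactlySupported_between hC hU hCU
  have h1 := ((ENNReal.continuous_ofReal.tendsto _).comp (hlim f)).eventually_lt_const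
    ((hf μ inferInstance).2.trans_lt hUc)
  filter_upwards [h1] with i hi
  exact (hf (m i) inferInstance).1.trans_lt hi

theorem tendsto_measure_of_vague_limit {F : Ultrafilter ι}
    (hlim : ∀ f : C_c(X, ℝ), Tendsto (fun i => ∫ x, f x ∂(m i)) F (𝓝 (∫ x, f x ∂μ)))
    {W : Set X} (hW : IsOpen W) (hC : IsCompact W) :
    Tendsto (fun i => m i W) F (𝓝 (μ W)) := by
  refine tendsto_order.2 ⟨fun c hc => ?_, fun c hc =>
    eventually_measure_lt_of_vague_limit hlim hC hc⟩
  by_contra hcon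
  rw [Ultrafilter.eventually_not.symm] at hcon
  exact absurd hc (not_lt.2 (measure_le_of_vague_limit hlim hW
    (hcon.mono fun i hi => not_lt.1 hi)))

/-- Each family of integrals stays in a compact interval and so converges along `F`; the limits form
a positive functional, represented by Riesz–Markov–Kakutani. -/
theorem exists_vague_limit (F : Ultrafilter ι)
    (hB : ∀ C : Set X, IsCompact C → ∃ B : ℝ≥0, ∀ i, m i C ≤ B) :
    ∃ μ : Measure X, μ.Regular ∧
      ∀ f : C_c(X, ℝ), Tendsto (fun i => ∫ x, f x ∂(m i)) F (𝓝 (∫ x, f x ∂μ)) := by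
  have hL : ∀ f : C_c(X, ℝ), ∃ l : ℝ, Tendsto (fun i => ∫ x, f x ∂(m i)) F (𝓝 l) := by
    intro f
    obtain ⟨A, hA⟩ := f.continuous.bounded_above_of_compact_support f.hasCompactSupport
    obtain ⟨B, hB⟩ := hB _ f.hasCompactSupport
    have hbd : ∀ i, ∫ x, f x ∂(m i) ∈ Metric.closedBall (0 : ℝ) (max A 0 * B) := by
      intro i
      rw [mem_closedBall_zero_iff, ← setIntegral_eq_integral_of_forall_compl_eq_zero
        (s := tsupport f) fun x hx => image_eq_zero_of_notMem_tsupport hx]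
      have h1 := norm_setIntegral_le_of_norm_le_const (μ := m i) (s := tsupport f) (f := f)
        (C := max A 0) f.hasCompactSupport.isCompact.measure_lt_top
        fun x _ => (hA x).trans (le_max_left _ _)
      refine h1.trans (mul_le_mul_of_nonneg_left ?_ (le_max_right _ _))
      exact ENNReal.toReal_le_of_le_ofReal B.2 (by simpa using hB i)
    obtain ⟨l, -, hl⟩ := (isCompact_closedBall (0 : ℝ) (max A 0 * B)).ultrafilter_le_nhds
      (F.map fun i => ∫ x, f x ∂(m i)) (by
        rw [le_principal_iff]
        exact Eventually.of_forall (f := F) hbd)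
    exact ⟨l, hl⟩
  choose L hL using hL
  let Λ : C_c(X, ℝ) →ₚ[ℝ] ℝ := PositiveLinearMap.mk₀
    { toFun := L
      map_add' := fun f g => tendsto_nhds_unique (hL (f + g)) (by
        refine ((hL f).add (hL g)).congr fun i => ?_
        exact (integral_add f.integrable g.integrable).symm)
      map_smul' := fun c f => tendsto_nhds_unique (hL (c • f)) (by
        refine ((hL f).const_smul c).congr fun i => ?_
        exact (integral_smul c f).symm) }
    fun f hf => ge_of_tendsto' (hL f) fun i => integral_nonneg hf
  refine ⟨RealRMK.rieszMeasure Λ, inferInstance, fun f => ?_⟩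
  rw [RealRMK.integral_rieszMeasure]
  exact hL f

theorem ext_of_forall_isCompact {μ ν : Measure X} [μ.Regular] [ν.Regular]
    (h : ∀ C, IsCompact C → μ C = ν C) : μ = ν := by
  apply Measure.OuterRegular.ext_isOpen
  apply Measure.InnerRegularWRT.eq_of_innerRegularWRT_of_forall_eq Measure.Regular.innerRegular
    Measure.Regular.innerRegular
  exact h

end VagueLimit

/-! ### Limits of subgroups and invariance of the limit measure -/

section LimitSubgroup

variable {X : Type*} [Group X] [TopologicalSpace X] [IsTopologicalGroup X] {ι : Type*}

/-- The set of limits of points of a family of subgroups along a filter. -/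
def limitSubgroup (S : ι → Subgroup X) (F : Filter ι) : Subgroup X where
  carrier := {x | ∀ U ∈ 𝓝 x, ∀ᶠ i in F, ∃ y ∈ U, y ∈ S i}
  one_mem' := fun _ hU => Eventually.of_forall fun i => ⟨1, mem_of_mem_nhds hU, (S i).one_mem⟩
  mul_mem' := by
    intro x y hx hy U hU
    have h : (fun z : X × X => z.1 * z.2) ⁻¹' U ∈ 𝓝 (x, y) :=
      continuous_mul.continuousAt.preimage_mem_nhds hU
    obtain ⟨A, hA, B, hB, hAB⟩ := mem_nhds_prod_iff.1 h
    filter_upwards [hx A hA, hy B hB] with i ⟨a, ha, haS⟩ ⟨b, hb, hbS⟩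
    exact ⟨a * b, hAB (mk_mem_prod ha hb), (S i).mul_mem haS hbS⟩
  inv_mem' := by
    intro x hx U hU
    filter_upwards [hx _ (continuous_inv.continuousAt.preimage_mem_nhds hU)] with i ⟨a, ha, haS⟩
    exact ⟨a⁻¹, ha, (S i).inv_mem haS⟩

theorem isClosed_limitSubgroup (S : ι → Subgroup X) (F : Filter ι) :
    IsClosed (limitSubgroup S F : Set X) := by
  refine isClosed_of_closure_subset fun x hx U hU => ?_
  obtain ⟨V, hVU, hV, hxV⟩ := mem_nhds_iff.1 hU
  obtain ⟨y, hyV, hy⟩ := mem_closure_iff.1 hx V hV hxV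
  exact hy U (mem_of_superset (hV.mem_nhds hyV) hVU)

variable [T2Space X] [LocallyCompactSpace X] [MeasurableSpace X] [BorelSpace X]
  {m : ι → Measure X} [∀ i, IsFiniteMeasureOnCompacts (m i)] {S : ι → Subgroup X}
  {μ : Measure X} [μ.Regular]

/-- Along an ultrafilter, a point outside the limit subgroup has a neighbourhood that eventually
misses `S i`, hence is null for `m i` and, once shrunk to an open set, for `μ`. -/
theorem measure_compl_limitSubgroup [SecondCountableTopology X] {F : Ultrafilter ι}
    (hlim : ∀ f : C_c(X, ℝ), Tendsto (fun i => ∫ x, f x ∂(m i)) F (𝓝 (∫ x, f x ∂μ)))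
    (hS : ∀ i, m i (S i : Set X)ᶜ = 0) : μ (limitSubgroup S F : Set X)ᶜ = 0 := by
  refine measure_null_of_locally_null _ fun x hx => ?_
  have hx' : ¬ ∀ U ∈ 𝓝 x, ∀ᶠ i in F, ∃ y ∈ U, y ∈ S i := hx
  push Not at hx'
  obtain ⟨U, hU, h⟩ := hx'
  obtain ⟨V, hVU, hV, hxV⟩ := mem_nhds_iff.1 hU
  refine ⟨V, mem_nhdsWithin_of_mem_nhds (hV.mem_nhds hxV), ?_⟩
  refine nonpos_iff_eq_zero.1 (measure_le_of_vague_limit hlim hV ?_)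
  filter_upwards [h] with i hi
  rw [← hS i]
  exact measure_mono fun y hy hyS => hi y (hVU hy) hyS

/-- Approximate `x` by `y ∈ S i`: invariance replaces `x • C` by `(y⁻¹ * x) • C`, which stays in a
small compact neighbourhood `C'` of `C`. The factor `V₂` thickens `C` to an open set, as the limit
estimate requires. -/
theorem measure_smul_le_of_vague_limit {F : Filter ι} [F.NeBot]
    (hlim : ∀ f : C_c(X, ℝ), Tendsto (fun i => ∫ x, f x ∂(m i)) F (𝓝 (∫ x, f x ∂μ)))
    (hinv : ∀ i, ∀ x ∈ S i, ∀ s : Set X, m i (x • s) = m i s)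
    {x : X} (hx : x ∈ limitSubgroup S F) {C : Set X} (hC : IsCompact C) : μ (x • C) ≤ μ C := by
  rw [C.measure_eq_iInf_isOpen μ]
  refine le_iInf₂ fun U hCU => le_iInf fun hU => ?_
  obtain ⟨C', hC', hCC', hC'U⟩ := exists_compact_between hC hU hCU
  refine le_trans (le_of_forall_gt fun c hc => ?_) (measure_mono hC'U)
  obtain ⟨V, hV, hVC⟩ := compact_open_separated_mul_left hC isOpen_interior hCC'
  obtain ⟨V₂, hV₂o, hV₂1, hV₂⟩ := exists_open_nhds_one_mul_subset hV
  obtain ⟨c', hc', hcc'⟩ := exists_between hc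
  have hnhds : {y : X | y⁻¹ * x ∈ V₂} ∈ 𝓝 x := by
    have hcont : Continuous fun y : X => y⁻¹ * x := by fun_prop
    exact hcont.continuousAt.preimage_mem_nhds (hV₂o.mem_nhds (by simpa using hV₂1))
  refine lt_of_le_of_lt ?_ hcc'
  calc μ (x • C) ≤ μ (x • (V₂ * C)) :=
        measure_mono (smul_set_mono fun y hy => ⟨1, hV₂1, y, hy, one_mul y⟩)
    _ ≤ c' := by
      refine measure_le_of_vague_limit hlim (hV₂o.mul_right.smul x) ?_
      filter_upwards [hx _ hnhds, eventually_measure_lt_of_vague_limit hlim hC' hc']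
        with i ⟨y, hy, hyS⟩ hi
      rw [← hinv i y⁻¹ ((S i).inv_mem hyS), smul_smul]
      refine (measure_mono ?_).trans hi.le
      rintro _ ⟨_, ⟨v, hv, z, hz, rfl⟩, rfl⟩
      refine interior_subset (hVC ⟨y⁻¹ * x * v, hV₂ ⟨_, hy, v, hv, rfl⟩, z, hz, ?_⟩)
      simp [mul_assoc]

theorem map_mul_left_of_vague_limit {F : Filter ι} [F.NeBot]
    (hlim : ∀ f : C_c(X, ℝ), Tendsto (fun i => ∫ x, f x ∂(m i)) F (𝓝 (∫ x, f x ∂μ)))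
    (hinv : ∀ i, ∀ x ∈ S i, ∀ s : Set X, m i (x • s) = m i s)
    {x : X} (hx : x ∈ limitSubgroup S F) : μ.map (x * ·) = μ := by
  have hreg : (μ.map (x * ·)).Regular := Measure.Regular.map (Homeomorph.mulLeft x)
  refine ext_of_forall_isCompact fun C hC => ?_
  rw [Measure.map_apply (measurable_const_mul x) hC.measurableSet]
  have h1 : (x * ·) ⁻¹' C = x⁻¹ • C := by
    ext y
    simp [mem_smul_set_iff_inv_smul_mem]
  rw [h1]
  refine le_antisymm (measure_smul_le_of_vague_limit hlim hinv (inv_mem hx) hC) ?_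
  have := measure_smul_le_of_vague_limit hlim hinv hx (hC.smul x⁻¹)
  rwa [smul_inv_smul] at this

end LimitSubgroup

/-! ### Limits of polyhomomorphisms are polyhomomorphisms -/

section Limit

variable {G H : Type*}
  [Group G] [TopologicalSpace G] [IsTopologicalGroup G] [T2Space G] [LocallyCompactSpace G]
  [SecondCountableTopology G] [MeasurableSpace G] [BorelSpace G]
  [Group H] [TopologicalSpace H] [IsTopologicalGroup H] [T2Space H] [LocallyCompactSpace H]
  [SecondCountableTopology H] [MeasurableSpace H] [BorelSpace H]
  {γ : Measure G} [γ.IsHaarMeasure] {η : Measure H} [η.IsHaarMeasure]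

theorem map_le_of_vague_limit {X : Type*} [TopologicalSpace X] [T2Space X] [LocallyCompactSpace X]
    [MeasurableSpace X] [BorelSpace X] {ι : Type*} {m : ι → Measure X}
    [∀ i, IsFiniteMeasureOnCompacts (m i)] {μ : Measure X} [μ.Regular] {F : Filter ι} [F.NeBot]
    (hlim : ∀ f : C_c(X, ℝ), Tendsto (fun i => ∫ x, f x ∂(m i)) F (𝓝 (∫ x, f x ∂μ)))
    {p : X → G} (hp : Continuous p) (hle : ∀ i, (m i).map p ≤ γ) : μ.map p ≤ γ := by
  refine Measure.le_iff.2 fun A hA => ?_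
  rw [A.measure_eq_iInf_isOpen γ]
  refine le_iInf₂ fun U hAU => le_iInf fun hU => ?_
  refine (measure_mono hAU).trans ?_
  rw [Measure.map_apply hp.measurable hU.measurableSet]
  refine measure_le_of_vague_limit hlim (hU.preimage hp) (Eventually.of_forall fun i => ?_)
  rw [← Measure.map_apply hp.measurable hU.measurableSet]
  exact hle i U

theorem exists_limit (F : Ultrafilter (Nonzero γ η)) :
    ∃ P : Polh γ η, P.meas.Regular ∧ ∀ f : C_c(G × H, ℝ),
      Tendsto (fun R : Nonzero γ η => ∫ x, f x ∂(R.meas)) F (𝓝 (∫ x, f x ∂(P.meas))) := by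
  obtain ⟨μ, hμ, hlim⟩ := exists_vague_limit (m := fun R : Nonzero γ η => R.meas) F (by
    intro C hC
    have hC' := hC.image continuous_fst
    refine ⟨(γ (Prod.fst '' C)).toNNReal, fun R => ?_⟩
    rw [ENNReal.coe_toNNReal hC'.measure_lt_top.ne]
    exact (measure_mono (subset_preimage_image _ _)).trans
      ((Measure.le_map_apply measurable_fst.aemeasurable _).trans (R.map_fst_le _)))
  by_cases h0 : μ = 0
  · subst h0
    exact ⟨.zero, hμ, hlim⟩
  let S : Nonzero γ η :=
    { rel := limitSubgroup (fun R : Nonzero γ η => R.rel) F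
      meas := μ
      isClosed_rel := isClosed_limitSubgroup _ _
      isHaar := exists_haar_of_invariant (isClosed_limitSubgroup _ _) μ h0
        (measure_compl_limitSubgroup hlim fun R => R.meas_compl)
        fun x hx => map_mul_left_of_vague_limit hlim (fun R _ hx s => R.meas_smul hx s) hx
      map_fst_le := map_le_of_vague_limit hlim continuous_fst fun R => R.map_fst_le
      map_snd_le := map_le_of_vague_limit hlim continuous_snd fun R => R.map_snd_le }
  exact ⟨.ofNonzero S, hμ, hlim⟩

end Limit

/-! ### Integrality of the constants under limits -/

section Constants

variable {G H : Type*}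
  [Group G] [TopologicalSpace G] [IsTopologicalGroup G] [T2Space G] [LocallyCompactSpace G]
  [SecondCountableTopology G] [MeasurableSpace G] [BorelSpace G]
  [Group H] [TopologicalSpace H] [IsTopologicalGroup H] [T2Space H] [LocallyCompactSpace H]
  [SecondCountableTopology H] [MeasurableSpace H] [BorelSpace H]
  {γ : Measure G} [γ.IsHaarMeasure] {η : Measure H} [η.IsHaarMeasure]

theorem relIndex_mul_measure (γ : Measure G) [γ.IsHaarMeasure] {M D : Subgroup G} (hDM : D ≤ M)
    (hM : IsCompact (M : Set G)) (hD : IsOpen (D : Set G)) :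
    (D.relIndex M : ℝ≥0∞) * γ D = γ M := by
  have hMm := hM.measurableSet
  have hemb : MeasurableEmbedding M.subtype := MeasurableEmbedding.subtype_coe hMm
  have : (γ.comap M.subtype).IsMulLeftInvariant := Measure.IsMulLeftInvariant.comap γ hemb
  have : (D.subgroupOf M).FiniteIndex := ⟨relIndex_ne_zero_of_isCompact hM hD⟩
  have h := Subgroup.index_mul_measure (D.subgroupOf M)
    ((hD.preimage continuous_subtype_val).measurableSet) (γ.comap M.subtype)
  rw [hemb.comap_apply, hemb.comap_apply, image_univ] at h
  have h1 : M.subtype '' (D.subgroupOf M : Set M) = D := by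
    rw [← Subgroup.coe_map, Subgroup.map_subgroupOf_eq_of_le hDM]
  have h2 : range M.subtype = (M : Set G) := Subtype.range_coe
  rwa [h1, h2] at h

namespace Nonzero

theorem meas_subgroup (R : Nonzero γ η) {W : Subgroup (G × H)}
    (hW : IsOpen (W : Set (G × H))) :
    R.meas W = (R.alpha / ((W.comap (MonoidHom.inr G H)).relIndex (indef R.rel) : ℕ) : ℝ≥0) *
        γ (dom (R.rel ⊓ W) : Set G) := by
  have h := DFunLike.congr_fun (R.map_fst_restrict hW) univ
  rwa [Measure.map_apply measurable_fst MeasurableSet.univ, preimage_univ,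
    Measure.restrict_apply_univ, Measure.smul_apply, Measure.restrict_apply_univ,
    ENNReal.smul_def, smul_eq_mul] at h

/-- For a compact open box `W = M × K` with `indef R ≤ K` and `M` the domain of the part of `R` in
`W`, the mass `R.meas W` is exactly `α(R) γ(M)`. For the approximants `P`, the ratio `γ(M) / P.meas
W` is a product of elements of `Λ`, and it tends to `α(R)⁻¹`. -/
theorem inv_alpha_mem_of_tendsto {K₀ : Subgroup G} (hc : IsCompact (K₀ : Set G))
    (ho : IsOpen (K₀ : Set G)) {F : Filter (Nonzero γ γ)} [F.NeBot]
    (hF : ∀ᶠ P in F, ∃ n ∈ indexSemigroup G, P.alpha⁻¹ = (n : ℝ≥0)) (R : Nonzero γ γ)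
    (hlim : ∀ W : Set (G × G), IsOpen W → IsCompact W →
      Tendsto (fun P : Nonzero γ γ => P.meas W) F (𝓝 (R.meas W))) :
    ∃ n ∈ indexSemigroup G, R.alpha⁻¹ = (n : ℝ≥0) := by
  obtain ⟨K, hKc, hKo, hK, -⟩ := exists_compact_open_ge R.isCompact_indef ho hc ho
  set M : Subgroup G := dom (R.rel ⊓ K₀.prod K) with hM
  have hMo : IsOpen (M : Set G) := R.isOpen_dom_inf (ho.prod hKo)
  have hMK : M ≤ K₀ := by
    rintro _ ⟨x, hx, rfl⟩
    exact hx.2.1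
  have hMc : IsCompact (M : Set G) := hc.of_isClosed_subset (M.isClosed_of_isOpen hMo) hMK
  have hWo : IsOpen (M.prod K : Set (G × G)) := hMo.prod hKo
  have hWc : IsCompact (M.prod K : Set (G × G)) := hMc.prod hKc
  have hcomap : (M.prod K).comap (MonoidHom.inr G G) = K := by
    ext; simp [Subgroup.mem_prod]
  have hdom : dom (R.rel ⊓ M.prod K) = M := by
    refine le_antisymm ?_ ?_
    · rintro _ ⟨x, hx, rfl⟩
      exact hx.2.1
    · rintro _ ⟨x, hx, rfl⟩
      exact ⟨x, ⟨hx.1, ⟨x, hx, rfl⟩, hx.2.2⟩, rfl⟩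
  have hM0 : γ M ≠ 0 := (hMo.measure_pos γ ⟨1, one_mem _⟩).ne'
  have hMt : γ M ≠ ∞ := hMc.measure_lt_top.ne
  have hRW : R.meas (M.prod K) = R.alpha * γ M := by
    rw [R.meas_subgroup hWo, hcomap, hdom, Subgroup.relIndex_eq_one.2 hK]
    simp
  have hR0 := R.alpha_ne_zero
  have hratio : Tendsto (fun P : Nonzero γ γ => γ M / P.meas (M.prod K)) F
      (𝓝 ((R.alpha⁻¹ : ℝ≥0) : ℝ≥0∞)) := by
    have h1 := ENNReal.Tendsto.const_div (a := γ M) (hlim _ hWo hWc) (Or.inr hMt)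
    convert h1 using 2
    rw [hRW, ENNReal.coe_inv hR0, mul_comm, ENNReal.div_eq_inv_mul,
      ENNReal.mul_inv (Or.inl hM0) (Or.inl hMt), mul_comm, ← mul_assoc,
      ENNReal.mul_inv_cancel hM0 hMt, one_mul]
  have hmem : ∀ᶠ P : Nonzero γ γ in F, (γ M / P.meas (M.prod K)).toReal ∈
      (Nat.cast : ℕ → ℝ) '' (indexSemigroup G : Set ℕ) := by
    filter_upwards [hF] with P ⟨n, hn, hPn⟩
    have hDo : IsOpen (dom (P.rel ⊓ M.prod K) : Set G) := P.isOpen_dom_inf hWo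
    have hDM : dom (P.rel ⊓ M.prod K) ≤ M := by
      rintro _ ⟨x, hx, rfl⟩
      exact hx.2.1
    -- The ratio equals `α(P)⁻¹ [indef P : indef P ∩ K] [M : dom (P ∩ W)]`; the last index compares
    -- `γ(M)` with the measure of the smaller domain.
    refine ⟨_, mul_mem (mul_mem hn (relIndex_mem_indexSemigroup P.isCompact_indef hKo hc ho))
      (relIndex_mem_indexSemigroup hMc hDo hc ho), ?_⟩
    have hD0 : γ (dom (P.rel ⊓ M.prod K)) ≠ 0 := (hDo.measure_pos γ ⟨1, one_mem _⟩).ne'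
    have hDt : γ (dom (P.rel ⊓ M.prod K)) ≠ ∞ := measure_ne_top_of_subset hDM hMt
    have hk : ((K.relIndex (indef P.rel) : ℕ) : ℝ) ≠ 0 := by
      exact_mod_cast relIndex_ne_zero_of_isCompact P.isCompact_indef hKo
    have hPa : (P.alpha : ℝ) ≠ 0 := by exact_mod_cast P.alpha_ne_zero
    have hg : (γ (dom (P.rel ⊓ M.prod K))).toReal ≠ 0 := ENNReal.toReal_ne_zero.2 ⟨hD0, hDt⟩
    have hPn' : (P.alpha : ℝ)⁻¹ = n := by exact_mod_cast congrArg NNReal.toReal hPn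
    rw [P.meas_subgroup hWo, hcomap, ← relIndex_mul_measure γ hDM hMc hDo]
    simp only [ENNReal.toReal_div, ENNReal.toReal_mul, ENNReal.toReal_natCast,
      ENNReal.coe_toReal, NNReal.coe_div, NNReal.coe_natCast, Nat.cast_mul]
    rw [← hPn']
    field_simp
  have hreal : Tendsto (fun P : Nonzero γ γ => (γ M / P.meas (M.prod K)).toReal) F
      (𝓝 ((R.alpha⁻¹ : ℝ≥0) : ℝ)) :=
    (ENNReal.tendsto_toReal ENNReal.coe_ne_top).comp hratio
  -- Every set of natural numbers is closed in `ℝ`, so the limit stays in `Λ`.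
  have hclosed : IsClosed ((Nat.cast : ℕ → ℝ) '' (indexSemigroup G : Set ℕ)) :=
    Nat.isClosedEmbedding_coe_real.isClosedMap _ (isClosed_discrete _)
  obtain ⟨n, hn, hna⟩ := hclosed.mem_of_tendsto hreal hmem
  exact ⟨n, hn, by exact_mod_cast hna.symm⟩

theorem inv_beta_mem_of_tendsto {K₀ : Subgroup G} (hc : IsCompact (K₀ : Set G))
    (ho : IsOpen (K₀ : Set G)) {F : Filter (Nonzero γ γ)} [F.NeBot]
    (hF : ∀ᶠ P in F, ∃ n ∈ indexSemigroup G, P.beta⁻¹ = (n : ℝ≥0)) (R : Nonzero γ γ)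
    (hlim : ∀ W : Set (G × G), IsOpen W → IsCompact W →
      Tendsto (fun P : Nonzero γ γ => P.meas W) F (𝓝 (R.meas W))) :
    ∃ n ∈ indexSemigroup G, R.beta⁻¹ = (n : ℝ≥0) := by
  rw [← R.alpha_swap]
  refine inv_alpha_mem_of_tendsto hc ho (F := F.map swap) ?_ R.swap fun W hW hWc => ?_
  · rw [eventually_map]
    simpa only [alpha_swap] using hF
  · have hsw : ∀ P : Nonzero γ γ, P.swap.meas W = P.meas (Prod.swap ⁻¹' W) := fun P =>
      Measure.map_apply measurable_swap hW.measurableSet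
    rw [tendsto_map'_iff, hsw]
    have h := hlim (Prod.swap ⁻¹' W) (hW.preimage continuous_swap)
      ((Homeomorph.prodComm G G).isClosedEmbedding.isCompact_preimage hWc)
    exact h.congr fun P => (hsw P).symm

end Nonzero

end Constants

/-! ### The Hausdorff property and compactness -/

section Topology

variable {G H : Type*}
  [Group G] [TopologicalSpace G] [IsTopologicalGroup G] [T2Space G] [LocallyCompactSpace G]
  [SecondCountableTopology G] [MeasurableSpace G] [BorelSpace G]
  [Group H] [TopologicalSpace H] [IsTopologicalGroup H] [T2Space H] [LocallyCompactSpace H]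
  [SecondCountableTopology H] [MeasurableSpace H] [BorelSpace H]
  {γ : Measure G} [γ.IsHaarMeasure] {η : Measure H} [η.IsHaarMeasure]

/-- The function `(g, h) ↦ φ(g) ψ(h)`. -/
def tensor (φ : C_c(G, ℝ)) (ψ : C_c(H, ℝ)) : C_c(G × H, ℝ) where
  toFun x := φ x.1 * ψ x.2
  continuous_toFun := (φ.continuous.comp continuous_fst).mul (ψ.continuous.comp continuous_snd)
  hasCompactSupport' := by
    refine HasCompactSupport.intro (φ.hasCompactSupport.isCompact.prod
      ψ.hasCompactSupport.isCompact) fun x hx => ?_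
    rw [mem_prod, not_and_or] at hx
    rcases hx with hx | hx
    · rw [image_eq_zero_of_notMem_tsupport hx, zero_mul]
    · rw [image_eq_zero_of_notMem_tsupport hx, mul_zero]

/-- A locally finite measure on a product is determined by the integrals of the functions
`φ(g) ψ(h)`. -/
theorem ext_of_integral_tensor {m m' : Measure (G × H)} [IsFiniteMeasureOnCompacts m]
    [IsFiniteMeasureOnCompacts m']
    (h : ∀ (φ : C_c(G, ℝ)) (ψ : C_c(H, ℝ)),
      ∫ x, φ x.1 * ψ x.2 ∂m = ∫ x, φ x.1 * ψ x.2 ∂m') : m = m' := by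
  refine ext_of_forall_isCompact fun C hC => ?_
  obtain ⟨φ, hφ1, -, hφc, hφ⟩ := exists_continuous_one_zero_of_isCompact
    (hC.image continuous_fst) isClosed_empty (disjoint_empty _)
  obtain ⟨ψ, hψ1, -, hψc, hψ⟩ := exists_continuous_one_zero_of_isCompact
    (hC.image continuous_snd) isClosed_empty (disjoint_empty _)
  -- Weighting by `θ`, which is `1` on `C`, makes both measures finite without changing the mass of
  -- `C`; finite measures are determined by products of bounded continuous functions.
  let θ : C_c(G × H, ℝ) := tensor ⟨φ, hφc⟩ ⟨ψ, hψc⟩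
  have hθ : ∀ x, 0 ≤ θ x := fun x => mul_nonneg (hφ _).1 (hψ _).1
  let d : G × H → ℝ≥0∞ := fun x => ENNReal.ofReal (θ x)
  have hd : Measurable d := θ.continuous.measurable.ennreal_ofReal
  have hfin : ∀ (ν : Measure (G × H)) [IsFiniteMeasureOnCompacts ν],
      IsFiniteMeasure (ν.withDensity d) := fun ν _ =>
    isFiniteMeasure_withDensity_ofReal θ.integrable.2
  have hint : ∀ (ν : Measure (G × H)) (f : BoundedContinuousFunction G ℝ)
      (g : BoundedContinuousFunction H ℝ),
      ∫ x, f x.1 * g x.2 ∂(ν.withDensity d) = ∫ x, (φ x.1 * f x.1) * (ψ x.2 * g x.2) ∂ν := by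
    intro ν f g
    rw [integral_withDensity_eq_integral_toReal_smul hd (ae_of_all _ fun x => ENNReal.ofReal_lt_top)]
    refine integral_congr_ae (ae_of_all _ fun x => ?_)
    simp only [d, ENNReal.toReal_ofReal (hθ x), smul_eq_mul]
    change (φ x.1 * ψ x.2) * _ = _
    ring
  have h1 := hfin m
  have h2 := hfin m'
  have heq : m.withDensity d = m'.withDensity d := by
    refine Measure.ext_of_integral_mul_boundedContinuousFunction fun f g => ?_
    rw [hint, hint]
    exact h ⟨⟨fun x => φ x * f x, φ.continuous.mul f.continuous⟩, hφc.mul_right⟩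
      ⟨⟨fun x => ψ x * g x, ψ.continuous.mul g.continuous⟩, hψc.mul_right⟩
  have hC' : ∀ ν : Measure (G × H), ν.withDensity d C = ν C := by
    intro ν
    rw [withDensity_apply _ hC.measurableSet, ← setLIntegral_one]
    refine setLIntegral_congr_fun hC.measurableSet fun x hx => ?_
    have e : θ x = 1 := by
      change φ x.1 * ψ x.2 = 1
      rw [hφ1 (mem_image_of_mem _ hx), hψ1 (mem_image_of_mem _ hx)]
      simp
    simp [d, e]
  rw [← hC' m, ← hC' m', heq]

/-- The relation is recovered as the support of its measure. -/
theorem Nonzero.ext_of_meas {R R' : Nonzero γ η} (h : R.meas = R'.meas) : R = R' := by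
  have key : ∀ {R R' : Nonzero γ η}, R.meas = R'.meas → R.rel ≤ R'.rel := by
    intro R R' h x hx
    by_contra hx'
    have h1 := R.meas_pos R'.isClosed_rel.isOpen_compl hx hx'
    rw [h, R'.meas_compl] at h1
    exact lt_irrefl _ h1
  exact Nonzero.ext (le_antisymm (key h) (key h.symm)) h

theorem Polh.meas_injective : Function.Injective (Polh.meas : Polh γ η → Measure (G × H)) := by
  rintro (_ | R) (_ | R') h
  · rfl
  · exact absurd h.symm R'.meas_ne_zero
  · exact absurd h R.meas_ne_zero
  · exact congrArg _ (Nonzero.ext_of_meas h)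

instance (P : Polh γ η) : IsFiniteMeasureOnCompacts P.meas := by
  rcases P with _ | R
  · exact inferInstanceAs (IsFiniteMeasureOnCompacts (0 : Measure (G × H)))
  · exact inferInstanceAs (IsFiniteMeasureOnCompacts R.meas)

instance : T2Space (Polh γ η) :=
  T2Space.of_injective_continuous (f := fun (R : Polh γ η) (p : C_c(G, ℝ) × C_c(H, ℝ)) =>
      ∫ x : G × H, (p.1 x.1 * p.2 x.2) ∂(R.meas))
    (fun _ _ h => Polh.meas_injective (ext_of_integral_tensor fun φ ψ => congrFun h (φ, ψ)))
    continuous_induced_dom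

theorem ofNonzero_injective :
    Function.Injective (Polh.ofNonzero : Nonzero γ η → Polh γ η) :=
  fun _ _ h => Polh.ofNonzero.inj h

theorem tendsto_ofNonzero {F : Filter (Nonzero γ η)} {P : Polh γ η}
    (h : ∀ f : C_c(G × H, ℝ),
      Tendsto (fun R : Nonzero γ η => ∫ x, f x ∂(R.meas)) F (𝓝 (∫ x, f x ∂(P.meas)))) :
    Tendsto Polh.ofNonzero F (𝓝 P) := by
  rw [nhds_induced, tendsto_comap_iff, tendsto_pi_nhds]
  exact fun p => h (tensor p.1 p.2)

theorem isCompact_polhΛ {K₀ : Subgroup G} (hc : IsCompact (K₀ : Set G))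
    (ho : IsOpen (K₀ : Set G)) : IsCompact (polhΛ γ) := by
  refine isCompact_iff_ultrafilter_le_nhds.2 fun F hF => ?_
  rw [le_principal_iff] at hF
  by_cases hr : range (Polh.ofNonzero : Nonzero γ γ → Polh γ γ) ∈ F
  · let F' : Ultrafilter (Nonzero γ γ) := F.comap ofNonzero_injective hr
    have hF' : (F : Filter (Polh γ γ)) = map Polh.ofNonzero (F' : Filter (Nonzero γ γ)) := by
      rw [Ultrafilter.coe_comap, map_comap_of_mem hr]
    have hΛ : ∀ᶠ R : Nonzero γ γ in F', (∃ n ∈ indexSemigroup G, R.alpha⁻¹ = (n : ℝ≥0)) ∧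
        ∃ n ∈ indexSemigroup G, R.beta⁻¹ = (n : ℝ≥0) := by
      have h : ∀ᶠ P in (F : Filter (Polh γ γ)), P ∈ polhΛ γ := hF
      rw [hF', eventually_map] at h
      filter_upwards [h] with R hR
      rcases hR with hR | ⟨R', hR, h⟩
      · cases hR
      · rw [ofNonzero_injective hR]
        exact h
    obtain ⟨P, hreg, hlim⟩ := exists_limit F'
    refine ⟨P, ?_, hF' ▸ tendsto_ofNonzero hlim⟩
    rcases P with _ | R
    · exact Or.inl rfl
    have hW : ∀ W : Set (G × G), IsOpen W → IsCompact W →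
        Tendsto (fun P : Nonzero γ γ => P.meas W) F' (𝓝 (R.meas W)) := by
      have hreg' : R.meas.Regular := hreg
      exact fun W hW hWc => tendsto_measure_of_vague_limit hlim hW hWc
    exact Or.inr ⟨R, rfl, R.inv_alpha_mem_of_tendsto hc ho (hΛ.mono fun _ h => h.1) hW,
      R.inv_beta_mem_of_tendsto hc ho (hΛ.mono fun _ h => h.2) hW⟩
  -- An ultrafilter not concentrated on nonzero elements is principal at zero.
  · refine ⟨.zero, Or.inl rfl, ?_⟩
    refine le_trans ?_ (pure_le_nhds _)
    rw [le_pure_iff]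
    filter_upwards [Ultrafilter.compl_mem_iff_notMem.2 hr] with P hP
    rcases P with _ | R
    · rfl
    · exact absurd ⟨R, rfl⟩ hP

end Topology

end Polyhom

theorem mainTheorem6 {G : Type*} [Group G] [TopologicalSpace G] [IsTopologicalGroup G] [T2Space G]
    [LocallyCompactSpace G] [SecondCountableTopology G] [MeasurableSpace G] [BorelSpace G]
    (γ : Measure G) [γ.IsHaarMeasure] [γ.IsMulRightInvariant]
    (K₀ : Subgroup G) (hK₀c : IsCompact (K₀ : Set G)) (hK₀o : IsOpen (K₀ : Set G))
    (hK₀ : γ (K₀ : Set G) = 1) :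
    ∃ _ : Semigroup (Polyhom.Polh γ γ),
      (∀ T R S : Polyhom.Polh γ γ, Polyhom.IsProduct T R S ↔ S = T * R) ∧
      ∃ P : Subsemigroup (Polyhom.Polh γ γ),
        (P : Set (Polyhom.Polh γ γ)) = Polyhom.polhΛ γ ∧
        IsCompact (Polyhom.polhΛ γ) ∧ IsClosed (Polyhom.polhΛ γ) := by
  have hcomp := Polyhom.isCompact_polhΛ (γ := γ) hK₀c hK₀o
  let := Polyhom.polhSemigroup γ
  exact ⟨Polyhom.polhSemigroup γ, Polyhom.isProduct_iff,
    { carrier := Polyhom.polhΛ γ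
      mul_mem' := Polyhom.prod_mem_polhΛ hK₀c hK₀o }, rfl, hcomp, hcomp.isClosed⟩
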